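/- **Setting.** Let $\rho$ be an $n$-qubit state, $O$ a Hermitian operator, $V_1,\dots,V_m$ unitaries and $H_1,\dots,H_m$ Hermitian operators on $n$ qubits. For $\theta\in\mathbb R^m$ put $$U(\theta)=V_1e^{-i\theta_1H_1}\,V_2e^{-i\theta_2H_2}\cdots V_me^{-i\theta_mH_m},\qquad \mathcal L(\theta)=\mathrm{Tr}[U(\theta)\rho U(\theta)^\dagger O]$$ (each rotation has its own parameter; the gate with label $m$ acts first on the state). For $\phi\in\mathbb R^m$ and $r>0$ let $\mathcal D(\phi,r)$ be the uniform distribution on $\prod_{i}[\phi_i-r,\phi_i+r]$. With $\|\cdot\|$ the operator norm, define $$c_l(\phi)=\left|\partial_{\theta_l}^2\mathcal L(\phi)\right|,\qquad \omega_l=\lambda_{\max}(H_l)-\lambda_{\min}(H_l),$$ $$\omega^{\rm eff}_\mu(\phi)=\left\|\partial_{\theta_\mu}^2[U(\theta)^\dagger OU(\theta)]_{\theta=\phi}\right\|^{1/2},\qquad \widetilde\omega^{\rm eff}_{l,\mu}(\phi)=\left\|\partial_{\theta_\mu}^2\partial_{\theta_l}^2[U(\theta)^\dagger OU(\theta)]_{\theta=\phi}\right\|^{1/2},$$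 $$F_l(\phi)=4\omega_l^2\sum_{\mu<l}\omega^{\rm eff}_\mu(\phi)^2+\sum_{\mu>l}\widetilde\omega^{\rm eff}_{l,\mu}(\phi)^2,\qquad \alpha_l(\phi)=\tfrac16F_l(\phi),$$ $$\beta_1=\tfrac23\,\omega_1^2\,\omega^{\rm eff}_1(\phi)^4,\qquad \beta_l=\tfrac{32}3\,\omega_l^6\,\|O\|^2\quad(l>1),$$ and, for a nonempty set $\Lambda\subseteq\{1,\dots,m\}$, $$r_{\rm patch}^2=\min_{l\in\Lambda}\frac{9\,c_l(\phi)^2}{8\,c_l(\phi)F_l(\phi)+24\,\beta_l}$$ (a quotient $0/0$ is read as $0$). **Theorem.** (i) For all $\phi$, all nonempty $\Lambda$ and all $r>0$ with $r^2\le r_{\rm patch}^2$, $$\mathrm{Var}_{\theta\sim\mathcal D(\phi,r)}[\mathcal L(\theta)]\ \ge\ \sum_{l\in\Lambda}\frac{r^4}{45}\Big[\big(c_l(\phi)-\alpha_l(\phi)r^2\big)^2-\beta_lr^2\Big]\qquad\text{and}\qquad \mathrm{Var}_{\theta\sim\mathcal D(\phi,r)}[\mathcal L(\theta)]\ \ge\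 \frac1{72}\Big(\sum_{l\in\Lambda}c_l(\phi)^2\Big)r^4 ,$$ and the second bound holds in particular for $r=r_{\rm patch}$ if $r_{\rm patch}>0$. (ii) For all exponents $a,b,c\in\mathbb N$ there is $k_0\in\mathbb N$ such that for every $k_1\in\mathbb N$ there is $k_2\in\mathbb N$ with the following property. Consider any family of problems as above indexed by $n\in\mathbb N$, with $n$ qubits, $m=m(n)$ parameters, points $\phi=\phi(n)$ and labels $q=q(n)\in\{1,\dots,m(n)\}$, such that $\|O\|\in\mathcal O(n^a)$, $\|H_k\|\in\mathcal O(n^b)$ uniformly in $k$, and $c_q(\phi)\in\Omega(n^{-c})$. If $p:\mathbb N\to\mathbb R$ is polynomially bounded and grows fast enough, namely $|p(n)|\in\Omega(n^{k_0})\cap\mathcal O(n^{k_1})$, and $r(n)>0$ satisfies $r\in\Theta\big(1/(|p(n)|\sqrt m)\big)$, then $$\mathrm{Var}_{\theta\sim\mathcal D(\phi,r)}[\mathcal L(\theta)]\in\Omega\!\left(\frac1{n^{k_2}\,m^2}\right).$$ -/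

import Mathlib

open MeasureTheory ProbabilityTheory Filter Asymptotics
open scoped Matrix ComplexOrder Matrix.Norms.L2Operator

noncomputable section

/-- Computational basis labels of `n` qubits. -/
abbrev Qubits (n : ℕ) : Type := Fin n → Fin 2

/-- Operators on the `n`-qubit space `(ℂ²)^{⊗ n}`. Their norm `‖·‖` is the spectral (operator) norm. -/
abbrev QOp (n : ℕ) : Type := Matrix (Qubits n) (Qubits n) ℂ

/-- A variational problem on `n` qubits with `m` independent parameters: an input state, an
observable, fixed unitary gates `V₁, …, V_m` and Hermitian generators `H₁, …, H_m`. The index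
`l : Fin m` stands for the label `l + 1 ∈ {1, …, m}`. -/
structure VarProblem (n m : ℕ) where
  state : QOp n
  state_posSemidef : state.PosSemidef
  state_trace : state.trace = 1
  obs : QOp n
  obs_isHermitian : obs.IsHermitian
  fixedGate : Fin m → QOp n
  fixedGate_unitary : ∀ l, fixedGate l ∈ Matrix.unitaryGroup (Qubits n) ℂ
  gen : Fin m → QOp n
  gen_isHermitian : ∀ l, (gen l).IsHermitian

/-- Second partial derivative of `f` with respect to the `l`-th coordinate. -/
def partialSq {m : ℕ} {E : Type*} [NormedAddCommGroup E] [NormedSpace ℝ E]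
    (l : Fin m) (f : (Fin m → ℝ) → E) (φ : Fin m → ℝ) : E :=
  iteratedDeriv 2 (fun t : ℝ => f (Function.update φ l t)) (φ l)

/-- The hypercube of half-width `r` centred at `φ`. -/
def cube {m : ℕ} (φ : Fin m → ℝ) (r : ℝ) : Set (Fin m → ℝ) :=
  {θ | ∀ i, θ i ∈ Set.Icc (φ i - r) (φ i + r)}

/-- The uniform distribution on the hypercube: normalized Lebesgue measure. -/
def cubeUniform {m : ℕ} (φ : Fin m → ℝ) (r : ℝ) : Measure (Fin m → ℝ) :=
  ProbabilityTheory.cond volume (cube φ r)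

/-- The maximal frequency `λ_max(H) - λ_min(H)` of a Hermitian operator. -/
def maxFreqOf {n : ℕ} {H : QOp n} (hH : H.IsHermitian) : ℝ :=
  (⨆ i, hH.eigenvalues i) - ⨅ i, hH.eigenvalues i

namespace VarProblem

variable {n m : ℕ} (P : VarProblem n m)

/-- The rotated gate `V_l e^{-i t H_l}`. -/
def gate (l : Fin m) (t : ℝ) : QOp n :=
  P.fixedGate l * NormedSpace.exp ((-(Complex.I * (t : ℂ))) • P.gen l)

/-- The circuit `U(θ) = V₁ e^{-iθ₁H₁} V₂ e^{-iθ₂H₂} ⋯ V_m e^{-iθ_mH_m}`; the last gate acts first on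
the state, the first one is closest to the observable. -/
def circuit (θ : Fin m → ℝ) : QOp n :=
  (List.ofFn fun l => P.gate l (θ l)).prod

/-- The loss `Tr[U(θ) ρ U(θ)† O]` (a real number, as `ρ` and `O` are Hermitian). -/
def loss (θ : Fin m → ℝ) : ℝ :=
  (P.circuit θ * P.state * (P.circuit θ)ᴴ * P.obs).trace.re

/-- The back-propagated observable `U(θ)† O U(θ)`. -/
def heisenberg (θ : Fin m → ℝ) : QOp n :=
  (P.circuit θ)ᴴ * P.obs * P.circuit θ

/-- The variance of the loss for `θ` uniform on the hypercube of half-width `r` around `φ`. -/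
def lossVar (φ : Fin m → ℝ) (r : ℝ) : ℝ :=
  ProbabilityTheory.variance P.loss (cubeUniform φ r)

/-- The curvature `c_l(φ)`. -/
def curv (φ : Fin m → ℝ) (l : Fin m) : ℝ :=
  |partialSq l P.loss φ|

/-- The maximal frequency of the `l`-th generator. -/
def maxFreq (l : Fin m) : ℝ :=
  maxFreqOf (P.gen_isHermitian l)

/-- The effective frequency of the parameter `μ` at `φ`. -/
def effFreq (φ : Fin m → ℝ) (μ : Fin m) : ℝ :=
  Real.sqrt ‖partialSq μ P.heisenberg φ‖

/-- The effective frequency of the pair of parameters `l`, `μ` at `φ`. -/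
def effFreq₂ (φ : Fin m → ℝ) (l μ : Fin m) : ℝ :=
  Real.sqrt ‖partialSq μ (partialSq l P.heisenberg) φ‖

/-- `4 ω_l² ∑_{μ<l} (ω_μ^eff)² + ∑_{μ>l} (ω_{l,μ}^eff)²`. -/
def freqSum (φ : Fin m → ℝ) (l : Fin m) : ℝ :=
  4 * P.maxFreq l ^ 2 * ∑ μ ∈ Finset.Iio l, P.effFreq φ μ ^ 2
    + ∑ μ ∈ Finset.Ioi l, P.effFreq₂ φ l μ ^ 2

/-- The coefficient `β_l`, with a separate value for the first label. -/
def beta (φ : Fin m → ℝ) (l : Fin m) : ℝ :=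
  if (l : ℕ) = 0 then 2 * P.maxFreq l ^ 2 * P.effFreq φ l ^ 4 / 3
  else 32 * P.maxFreq l ^ 6 * ‖P.obs‖ ^ 2 / 3

/-- The squared patch radius of the single parameter `l` (equal to `0` when `c_l(φ) = 0`). -/
def rPatchSqAt (φ : Fin m → ℝ) (l : Fin m) : ℝ :=
  9 * P.curv φ l ^ 2 / (8 * P.curv φ l * P.freqSum φ l + 24 * P.beta φ l)

/-- The squared patch radius of a nonempty set `Λ` of parameters. -/
def rPatchSq (φ : Fin m → ℝ) (Λ : Finset (Fin m)) (hΛ : Λ.Nonempty) : ℝ :=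
  Λ.inf' hΛ (P.rPatchSqAt φ)

/-- The patch radius of a nonempty set `Λ` of parameters. -/
def rPatch (φ : Fin m → ℝ) (Λ : Finset (Fin m)) (hΛ : Λ.Nonempty) : ℝ :=
  Real.sqrt (P.rPatchSq φ Λ hΛ)

end VarProblem

end

/-!
The centred quadratics `(θ_l - φ_l)² - r² / 3` are uncorrelated under the uniform distribution on
the cube and have variance `4 r⁴ / 45`, so Bessel's inequality bounds the variance of the loss from
below by the sum over `l ∈ Λ` of its squared covariances with them, divided by `4 r⁴ / 45`.

Taylor's formula of order four along the `l`-th coordinate shows that the `l`-th covariance is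
`2 r⁴ / 45` times the mean of `∂_l² L` over the slice `θ_l = φ_l`, up to the fourth derivative in
that direction. Replacing this mean by `∂_l² L (φ)` means freezing the other coordinates one at a
time; in increasing order, each second derivative in the direction `μ` is only needed at points that
agree with `φ` before `μ`.

This order is what makes the error terms depend on `φ` alone: every derivative of `U(θ)† O U(θ)` is
obtained by inserting nested commutators with `i H_μ` along the circuit, the later gates act by
unitary conjugation, and a rotation commutes with its own generator, so the norm of the derivative
depends only on the parameters that precede the last differentiated one. A nested commutator of
order `s` with `i H_μ` increases the norm by a factor of at most `(λ_max - λ_min)^s`, because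
subtracting the midpoint of the spectrum from `H_μ` does not change the commutator.
-/

section Taylor

theorem iteratedDeriv_of_hasDerivAt_succ {𝕜 E : Type*} [NontriviallyNormedField 𝕜]
    [NormedAddCommGroup E] [NormedSpace 𝕜 E] {u : ℕ → 𝕜 → E}
    (hu : ∀ i t, HasDerivAt (u i) (u (i + 1) t) t) (i : ℕ) : iteratedDeriv i (u 0) = u i := by
  induction i with
  | zero => exact iteratedDeriv_zero
  | succ i ih => rw [iteratedDeriv_succ, ih]; exact funext fun t => (hu i t).deriv

theorem contDiff_of_hasDerivAt_succ {𝕜 E : Type*} [NontriviallyNormedField 𝕜]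
    [NormedAddCommGroup E] [NormedSpace 𝕜 E] {u : ℕ → 𝕜 → E}
    (hu : ∀ i t, HasDerivAt (u i) (u (i + 1) t) t) (k : ℕ∞) : ContDiff 𝕜 k (u 0) := by
  refine contDiff_of_differentiable_iteratedDeriv fun i _ => ?_
  rw [iteratedDeriv_of_hasDerivAt_succ hu]
  exact fun t => (hu i t).differentiableAt

theorem abs_sub_taylorSum_le {k : ℕ} {f : ℝ → ℝ} {M : ℝ} (hf : ContDiff ℝ k f)
    (hM : ∀ t, |iteratedDeriv k f t| ≤ M) (x t : ℝ) :
    |f t - ∑ i ∈ Finset.range k, iteratedDeriv i f x / i.factorial * (t - x) ^ i|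
      ≤ M / k.factorial * |t - x| ^ k := by
  rcases k with - | k
  · simpa using hM t
  rcases eq_or_ne x t with rfl | hxt
  · simp [Finset.sum_range_succ']
  obtain ⟨s, -, hs⟩ := taylor_mean_remainder_lagrange_iteratedDeriv (n := k) hxt
    (by exact_mod_cast hf.contDiffOn)
  have hsum : taylorWithinEval f k (Set.uIcc x t) x t
      = ∑ i ∈ Finset.range (k + 1), iteratedDeriv i f x / i.factorial * (t - x) ^ i := by
    rw [taylor_within_apply]
    refine Finset.sum_congr rfl fun i hi => ?_
    rw [iteratedDerivWithin_eq_iteratedDeriv (uniqueDiffOn_uIcc hxt)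
      (hf.contDiffAt.of_le (by exact_mod_cast (Finset.mem_range.1 hi).le)) Set.left_mem_uIcc,
      smul_eq_mul]
    ring
  rw [← hsum, hs, abs_div, abs_mul, abs_pow, Nat.abs_cast, div_mul_eq_mul_div]
  gcongr
  exact hM s

end Taylor

section IntervalUniform

/-- The uniform distribution on the interval of half-width `r` centred at `x`, that is, the law of
one coordinate under `cubeUniform`. -/
noncomputable def intervalUniform (x r : ℝ) : Measure ℝ :=
  ProbabilityTheory.cond volume (Set.Icc (x - r) (x + r))

theorem isProbabilityMeasure_intervalUniform (x : ℝ) {r : ℝ} (hr : 0 < r) :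
    IsProbabilityMeasure (intervalUniform x r) :=
  cond_isProbabilityMeasure_of_finite (by simp [Real.volume_Icc]; linarith)
    (by simp [Real.volume_Icc])

theorem ae_mem_Icc_intervalUniform (x r : ℝ) :
    ∀ᵐ t ∂intervalUniform x r, t ∈ Set.Icc (x - r) (x + r) :=
  ae_cond_mem measurableSet_Icc

theorem integral_intervalUniform (x : ℝ) {r : ℝ} (hr : 0 < r) (f : ℝ → ℝ) :
    ∫ t, f t ∂intervalUniform x r = (2 * r)⁻¹ * ∫ t in (x - r)..(x + r), f t := by
  rw [intervalIntegral.integral_of_le (by linarith), ← integral_Icc_eq_integral_Ioc,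
    intervalUniform, ProbabilityTheory.cond, integral_smul_measure, Real.volume_Icc,
    show x + r - (x - r) = 2 * r by ring, ENNReal.toReal_inv,
    ENNReal.toReal_ofReal (by linarith), smul_eq_mul]

theorem integrable_intervalUniform (x : ℝ) {r : ℝ} (hr : 0 < r) {f : ℝ → ℝ} (hf : Continuous f) :
    Integrable f (intervalUniform x r) :=
  hf.continuousOn.integrableOn_Icc.smul_measure (by simp [Real.volume_Icc]; linarith)

theorem integral_intervalUniform_pow (x : ℝ) {r : ℝ} (hr : 0 < r) (k : ℕ) :
    ∫ t, (t - x) ^ k ∂intervalUniform x r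
      = (2 * r)⁻¹ * ((r ^ (k + 1) - (-r) ^ (k + 1)) / (k + 1)) := by
  rw [integral_intervalUniform x hr,
    intervalIntegral.integral_comp_sub_right (fun t => t ^ k) x, integral_pow]
  simp

theorem abs_integral_mul_sub_taylorSum_le {k : ℕ} {f w : ℝ → ℝ} {x r M W : ℝ} (hr : 0 < r)
    (hf : ContDiff ℝ k f) (hM : ∀ t, |iteratedDeriv k f t| ≤ M) (hw : Continuous w)
    (hW : ∀ t ∈ Set.Icc (x - r) (x + r), |w t| ≤ W) :
    |∫ t, f t * w t ∂intervalUniform x r - ∑ i ∈ Finset.range k,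
        iteratedDeriv i f x / i.factorial * ∫ t, (t - x) ^ i * w t ∂intervalUniform x r|
      ≤ M * W / k.factorial * ∫ t, |t - x| ^ k ∂intervalUniform x r := by
  have hfc : Continuous f := hf.continuous
  have hdiff : ∫ t, f t * w t ∂intervalUniform x r - ∑ i ∈ Finset.range k,
        iteratedDeriv i f x / i.factorial * ∫ t, (t - x) ^ i * w t ∂intervalUniform x r
      = ∫ t, (f t - ∑ i ∈ Finset.range k, iteratedDeriv i f x / i.factorial * (t - x) ^ i) * w t
          ∂intervalUniform x r := by
    simp only [sub_mul, Finset.sum_mul, mul_assoc, ← integral_const_mul]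
    rw [integral_sub, integral_finsetSum]
    · exact fun i _ => integrable_intervalUniform x hr (by fun_prop)
    · exact integrable_intervalUniform x hr (by fun_prop)
    · exact integrable_intervalUniform x hr (by fun_prop)
  rw [hdiff, ← integral_const_mul, ← Real.norm_eq_abs]
  refine norm_integral_le_of_norm_le (integrable_intervalUniform x hr (by fun_prop)) ?_
  filter_upwards [ae_mem_Icc_intervalUniform x r] with t ht
  have htaylor := abs_sub_taylorSum_le hf hM x t
  calc _ ≤ M / k.factorial * |t - x| ^ k * W := by
        rw [Real.norm_eq_abs, abs_mul]
        exact mul_le_mul htaylor (hW t ht) (abs_nonneg _) ((abs_nonneg _).trans htaylor)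
    _ = M * W / k.factorial * |t - x| ^ k := by ring

theorem abs_integral_intervalUniform_sub_le {f : ℝ → ℝ} {x r M : ℝ} (hr : 0 < r)
    (hf : ContDiff ℝ 2 f) (hM : ∀ t, |iteratedDeriv 2 f t| ≤ M) :
    |∫ t, f t ∂intervalUniform x r - f x| ≤ r ^ 2 / 6 * M := by
  have := isProbabilityMeasure_intervalUniform x hr
  have hmean := integral_intervalUniform_pow x hr 1
  have hsq := integral_intervalUniform_pow x hr 2
  have h := abs_integral_mul_sub_taylorSum_le (k := 2) (w := fun _ => 1) (x := x) hr hf hM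
    continuous_const (fun _ _ => abs_one.le)
  simp only [mul_one, sq_abs, Finset.sum_range_succ, Finset.sum_range_zero, pow_zero, pow_one,
    iteratedDeriv_zero, integral_const, probReal_univ, smul_eq_mul, Nat.factorial, hsq]
    at h hmean
  rw [hmean] at h
  convert h using 1
  · simp
  · field_simp
    push_cast
    ring

/-- The centred quadratic `(t - x) ^ 2 - r ^ 2 / 3`, whose mean under `intervalUniform x r` is `0`.
These functions of the single coordinates are the test functions in the variance bound. -/
noncomputable def centredSq (x r t : ℝ) : ℝ := (t - x) ^ 2 - r ^ 2 / 3

@[fun_prop]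
theorem continuous_centredSq (x r : ℝ) : Continuous (centredSq x r) := by
  unfold centredSq; fun_prop

theorem abs_centredSq_le {x r t : ℝ} (hr : 0 < r) (ht : t ∈ Set.Icc (x - r) (x + r)) :
    |centredSq x r t| ≤ 2 / 3 * r ^ 2 := by
  have hsq : (t - x) ^ 2 ≤ r ^ 2 := by
    rw [sq_le_sq, abs_of_pos hr, abs_le]
    constructor <;> linarith [ht.1, ht.2]
  rw [centredSq, abs_le]
  constructor <;> nlinarith [sq_nonneg (t - x), sq_nonneg r]

theorem integral_pow_mul_centredSq (x : ℝ) {r : ℝ} (hr : 0 < r) (k : ℕ) :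
    ∫ t, (t - x) ^ k * centredSq x r t ∂intervalUniform x r
      = (2 * r)⁻¹ * ((r ^ (k + 3) - (-r) ^ (k + 3)) / (k + 3))
        - r ^ 2 / 3 * ((2 * r)⁻¹ * ((r ^ (k + 1) - (-r) ^ (k + 1)) / (k + 1))) := by
  have h : ∀ t, (t - x) ^ k * centredSq x r t = (t - x) ^ (k + 2) - r ^ 2 / 3 * (t - x) ^ k := by
    intro t; unfold centredSq; ring
  simp only [h]
  rw [integral_sub (integrable_intervalUniform x hr (by fun_prop))
    (integrable_intervalUniform x hr (by fun_prop)), integral_const_mul,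
    integral_intervalUniform_pow x hr, integral_intervalUniform_pow x hr]
  push_cast
  ring

theorem integral_centredSq (x : ℝ) {r : ℝ} (hr : 0 < r) :
    ∫ t, centredSq x r t ∂intervalUniform x r = 0 := by
  have h := integral_pow_mul_centredSq x hr 0
  simp only [pow_zero, one_mul] at h
  rw [h]
  push_cast
  field_simp
  ring

theorem integral_centredSq_sq (x : ℝ) {r : ℝ} (hr : 0 < r) :
    ∫ t, centredSq x r t ^ 2 ∂intervalUniform x r = 4 * r ^ 4 / 45 := by
  have h : ∀ t, centredSq x r t ^ 2
      = (t - x) ^ 2 * centredSq x r t - r ^ 2 / 3 * centredSq x r t := by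
    intro t; unfold centredSq; ring
  simp only [h]
  rw [integral_sub (integrable_intervalUniform x hr (by fun_prop))
    (integrable_intervalUniform x hr (by fun_prop)), integral_const_mul, integral_centredSq x hr,
    integral_pow_mul_centredSq x hr]
  push_cast
  field_simp
  ring

theorem abs_integral_mul_centredSq_sub_le {f : ℝ → ℝ} {x r M : ℝ} (hr : 0 < r)
    (hf : ContDiff ℝ 4 f) (hM : ∀ t, |iteratedDeriv 4 f t| ≤ M) :
    |∫ t, f t * centredSq x r t ∂intervalUniform x r - 2 * r ^ 4 / 45 * iteratedDeriv 2 f x|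
      ≤ r ^ 6 / 180 * M := by
  have h := abs_integral_mul_sub_taylorSum_le (k := 4) hr hf hM (continuous_centredSq x r)
    (fun t ht => abs_centredSq_le hr ht)
  have hfourth : ∫ t, |t - x| ^ 4 ∂intervalUniform x r = r ^ 4 / 5 := by
    simp only [Even.pow_abs (n := 4) (by decide)]
    rw [integral_intervalUniform_pow x hr]
    push_cast
    field_simp
    ring
  rw [hfourth] at h
  simp only [integral_pow_mul_centredSq x hr, Finset.sum_range_succ, Finset.sum_range_zero,
    Nat.factorial] at h
  convert h using 1
  · congr 1
    push_cast
    field_simp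
    ring
  · push_cast
    ring

end IntervalUniform

section Bessel

theorem sum_covariance_sq_div_variance_le {Ω κ : Type*} {mΩ : MeasurableSpace Ω} {μ : Measure Ω}
    [IsProbabilityMeasure μ] {X : Ω → ℝ} {g : κ → Ω → ℝ} {s : Finset κ} (hX : MemLp X 2 μ)
    (hg : ∀ i ∈ s, MemLp (g i) 2 μ) (hgg : (s : Set κ).Pairwise fun i j => cov[g i, g j; μ] = 0) :
    ∑ i ∈ s, cov[X, g i; μ] ^ 2 / Var[g i; μ] ≤ Var[X; μ] := by
  set c : κ → ℝ := fun i => cov[X, g i; μ] / Var[g i; μ]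
  have hcg : ∀ i ∈ s, MemLp (fun ω => c i * g i ω) 2 μ := fun i hi => (hg i hi).const_mul (c i)
  have hY : MemLp (fun ω => ∑ i ∈ s, c i * g i ω) 2 μ := memLp_finsetSum s hcg
  have hXY : cov[X, fun ω => ∑ i ∈ s, c i * g i ω; μ]
      = ∑ i ∈ s, cov[X, g i; μ] ^ 2 / Var[g i; μ] := by
    rw [covariance_fun_sum_right' hcg hX]
    refine Finset.sum_congr rfl fun i _ => ?_
    rw [covariance_const_mul_right]
    ring
  have hYY : Var[fun ω => ∑ i ∈ s, c i * g i ω; μ]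
      = ∑ i ∈ s, cov[X, g i; μ] ^ 2 / Var[g i; μ] := by
    rw [variance_fun_sum' hcg]
    refine Finset.sum_congr rfl fun i hi => ?_
    rw [Finset.sum_eq_single_of_mem i hi fun j hj hji => by
      rw [covariance_const_mul_left, covariance_const_mul_right, hgg hi hj hji.symm]; ring,
      covariance_self (hcg i hi).aemeasurable, variance_const_mul]
    change (cov[X, g i; μ] / Var[g i; μ]) ^ 2 * Var[g i; μ] = _
    field_simp
  have hdist := variance_nonneg (fun ω => X ω - ∑ i ∈ s, c i * g i ω) μ
  rw [variance_fun_sub hX hY, hXY, hYY] at hdist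
  linarith

end Bessel

section ProductMeasure

variable {ι : Type*} [Fintype ι] {X : ι → Type*} [∀ i, MeasurableSpace (X i)]
  {E : Type*} [NormedAddCommGroup E] [NormedSpace ℝ E]

theorem measurePreserving_update [DecidableEq ι] (ν : ∀ i, Measure (X i))
    [∀ i, IsProbabilityMeasure (ν i)] (l : ι) :
    MeasurePreserving (fun p : (∀ i, X i) × X l => Function.update p.1 l p.2)
      ((Measure.pi ν).prod (ν l)) (Measure.pi ν) := by
  refine ⟨measurable_update', (Measure.pi_eq fun s hs => ?_).symm⟩
  have hpre : (fun p : (∀ i, X i) × X l => Function.update p.1 l p.2) ⁻¹' Set.univ.pi s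
      = Set.univ.pi (Function.update s l Set.univ) ×ˢ s l := by
    ext p
    simp only [Set.mem_preimage, Set.mem_prod, Set.mem_univ_pi]
    rw [Function.forall_update_iff p.1 fun i x => x ∈ s i,
      Function.forall_update_iff s fun i S => p.1 i ∈ S]
    simp [and_comm]
  rw [Measure.map_apply measurable_update' (MeasurableSet.univ_pi hs), hpre, Measure.prod_prod,
    Measure.pi_pi]
  simp only [Function.apply_update fun i => ν i]
  rw [Finset.prod_update_of_mem (Finset.mem_univ l), measure_univ, one_mul,
    Finset.sdiff_singleton_eq_erase, Finset.prod_erase_mul _ _ (Finset.mem_univ l)]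

variable {ν : ∀ i, Measure (X i)} [∀ i, IsProbabilityMeasure (ν i)]

theorem integrable_integral_update [DecidableEq ι] {F : (∀ i, X i) → E}
    (hF : Integrable F (Measure.pi ν)) (l : ι) :
    Integrable (fun θ => ∫ t, F (Function.update θ l t) ∂ν l) (Measure.pi ν) :=
  ((measurePreserving_update ν l).integrable_comp_of_integrable hF).integral_prod_left

theorem integral_pi_eq_integral_integral_update [DecidableEq ι] {F : (∀ i, X i) → E}
    (hF : Integrable F (Measure.pi ν)) (l : ι) :
    ∫ θ, F θ ∂Measure.pi ν = ∫ θ, ∫ t, F (Function.update θ l t) ∂ν l ∂Measure.pi ν := by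
  have hmp := measurePreserving_update ν l
  rw [integral_integral (f := fun θ t => F (Function.update θ l t))
    (hmp.integrable_comp_of_integrable hF)]
  conv_lhs => rw [← hmp.map_eq]
  exact integral_map hmp.aemeasurable (by rw [hmp.map_eq]; exact hF.aestronglyMeasurable)

theorem norm_integral_sub_integral_update_le [DecidableEq ι] {F : (∀ i, X i) → E} {l : ι}
    {x : X l} {C : ℝ} (hF : Integrable F (Measure.pi ν))
    (hFx : Integrable (fun θ => F (Function.update θ l x)) (Measure.pi ν))
    (hC : ∀ θ, ‖∫ t, F (Function.update θ l t) ∂ν l - F (Function.update θ l x)‖ ≤ C) :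
    ‖∫ θ, F θ ∂Measure.pi ν - ∫ θ, F (Function.update θ l x) ∂Measure.pi ν‖ ≤ C := by
  rw [integral_pi_eq_integral_integral_update hF l,
    ← integral_sub (integrable_integral_update hF l) hFx]
  simpa using norm_integral_le_of_norm_le_const (μ := Measure.pi ν) (ae_of_all _ hC)

theorem norm_integral_pi_sub_le_sum [LinearOrder ι] [CompleteSpace E] {F : (∀ i, X i) → E}
    {φ : ∀ i, X i} {C : ι → ℝ}
    (hF : ∀ s : Finset ι, Integrable (fun θ => F (s.piecewise φ θ)) (Measure.pi ν))
    (hC : ∀ l θ, (∀ i < l, θ i = φ i) →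
      ‖∫ t, F (Function.update θ l t) ∂ν l - F (Function.update θ l (φ l))‖ ≤ C l) :
    ‖∫ θ, F θ ∂Measure.pi ν - F φ‖ ≤ ∑ l, C l := by
  suffices hfreeze : ∀ s : Finset ι, IsLowerSet (s : Set ι) →
      ‖∫ θ, F θ ∂Measure.pi ν - ∫ θ, F (s.piecewise φ θ) ∂Measure.pi ν‖ ≤ ∑ l ∈ s, C l by
    simpa using hfreeze Finset.univ (by simpa using isLowerSet_univ)
  intro s
  induction s using Finset.induction_on_max with
  | empty => simp
  | insert l s hs ih =>
    intro hlower
    have hl : l ∉ s := fun h => lt_irrefl l (hs l h)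
    have hbelow : ∀ i < l, i ∈ s := fun i hi =>
      Finset.mem_of_mem_insert_of_ne (hlower hi.le (by simp)) hi.ne
    have hslower : IsLowerSet (s : Set ι) := fun i j hji hi => hbelow j (hji.trans_lt (hs i hi))
    have hinsert : ∀ θ, (insert l s).piecewise φ θ = s.piecewise φ (Function.update θ l (φ l)) :=
      fun θ => by rw [Finset.piecewise_insert, Finset.update_piecewise_of_notMem s φ θ hl]
    have hstep := norm_integral_sub_integral_update_le (x := φ l) (C := C l) (hF s)
      (by simpa only [hinsert] using hF (insert l s)) fun θ => by
        simp only [← Finset.update_piecewise_of_notMem s φ θ hl]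
        exact hC l _ fun i hi => Finset.piecewise_eq_of_mem s φ θ (hbelow i hi)
    simp only [hinsert]
    rw [Finset.sum_insert hl, add_comm]
    exact (norm_sub_le_norm_sub_add_norm_sub _ _ _).trans (add_le_add (ih hslower) hstep)

end ProductMeasure

section Cube

variable {m : ℕ}

theorem partialSq_update {E : Type*} [NormedAddCommGroup E] [NormedSpace ℝ E] (l : Fin m)
    (f : (Fin m → ℝ) → E) (θ : Fin m → ℝ) (t : ℝ) :
    partialSq l f (Function.update θ l t)
      = iteratedDeriv 2 (fun s => f (Function.update θ l s)) t := by
  simp [partialSq]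

theorem cube_eq_pi (φ : Fin m → ℝ) (r : ℝ) :
    cube φ r = Set.univ.pi fun i => Set.Icc (φ i - r) (φ i + r) := by
  ext θ
  simp only [cube, Set.mem_ofPred_eq, Set.mem_univ_pi]

variable (φ : Fin m → ℝ) {r : ℝ}

theorem cubeUniform_eq_pi (hr : 0 < r) :
    cubeUniform φ r = Measure.pi fun i => intervalUniform (φ i) r := by
  have := fun i => isProbabilityMeasure_intervalUniform (φ i) hr
  refine (Measure.pi_eq fun s _ => ?_).symm
  rw [cubeUniform, cube_eq_pi, cond_apply (MeasurableSet.univ_pi fun i => measurableSet_Icc),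
    ← Set.pi_inter_distrib, volume_pi, Measure.pi_pi, Measure.pi_pi]
  simp_rw [intervalUniform, cond_apply measurableSet_Icc, Finset.prod_mul_distrib]
  congr 1
  refine ENNReal.prod_inv_distrib fun i _ j _ _ => Or.inl ?_
  simp [Real.volume_Icc]
  linarith

theorem isProbabilityMeasure_cubeUniform (hr : 0 < r) :
    IsProbabilityMeasure (cubeUniform φ r) := by
  have := fun i => isProbabilityMeasure_intervalUniform (φ i) hr
  rw [cubeUniform_eq_pi φ hr]
  infer_instance

variable {f : (Fin m → ℝ) → ℝ}

theorem integrable_cubeUniform (hr : 0 < r) (hf : Continuous f) :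
    Integrable f (cubeUniform φ r) := by
  have hcompact : IsCompact (cube φ r) := by
    rw [cube_eq_pi]
    exact isCompact_univ_pi fun i => isCompact_Icc
  refine (hf.continuousOn.integrableOn_compact hcompact).smul_measure ?_
  rw [ENNReal.inv_ne_top, cube_eq_pi, volume_pi, Measure.pi_pi, Finset.prod_ne_zero_iff]
  intro i _
  simp [Real.volume_Icc]
  linarith

theorem memLp_two_cubeUniform (hr : 0 < r) (hf : Continuous f) :
    MemLp f 2 (cubeUniform φ r) :=
  (memLp_two_iff_integrable_sq hf.aestronglyMeasurable).2
    (integrable_cubeUniform φ hr (hf.pow 2))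

theorem integral_cubeUniform_eq_integral_update (hr : 0 < r) (hf : Continuous f)
    (l : Fin m) :
    ∫ θ, f θ ∂cubeUniform φ r
      = ∫ θ, ∫ t, f (Function.update θ l t) ∂intervalUniform (φ l) r ∂cubeUniform φ r := by
  have := fun i => isProbabilityMeasure_intervalUniform (φ i) hr
  have hint := integrable_cubeUniform φ hr hf
  rw [cubeUniform_eq_pi φ hr] at hint ⊢
  exact integral_pi_eq_integral_integral_update hint l

theorem covariance_centredSq (hr : 0 < r) (hf : Continuous f)
    (l : Fin m) :
    cov[f, fun θ => centredSq (φ l) r (θ l); cubeUniform φ r]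
      = ∫ θ, ∫ t, f (Function.update θ l t) * centredSq (φ l) r t ∂intervalUniform (φ l) r
          ∂cubeUniform φ r := by
  have := isProbabilityMeasure_cubeUniform φ hr
  rw [covariance_eq_sub (memLp_two_cubeUniform φ hr hf)
    (memLp_two_cubeUniform φ hr (by fun_prop)),
    integral_cubeUniform_eq_integral_update φ hr (f := fun θ => centredSq (φ l) r (θ l))
      (by fun_prop) l, integral_cubeUniform_eq_integral_update φ hr (by fun_prop) l]
  simp [integral_centredSq _ hr]

theorem variance_centredSq (hr : 0 < r) (l : Fin m) :
    Var[fun θ => centredSq (φ l) r (θ l); cubeUniform φ r] = 4 * r ^ 4 / 45 := by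
  have := isProbabilityMeasure_cubeUniform φ hr
  rw [← covariance_self (Continuous.aemeasurable (by fun_prop)),
    covariance_centredSq φ hr (by fun_prop)]
  simp [← pow_two, integral_centredSq_sq _ hr]

theorem covariance_centredSq_of_ne (hr : 0 < r) {l k : Fin m} (hlk : l ≠ k) :
    cov[fun θ => centredSq (φ l) r (θ l), fun θ => centredSq (φ k) r (θ k); cubeUniform φ r]
      = 0 := by
  rw [covariance_centredSq φ hr (by fun_prop)]
  simp [hlk, integral_const_mul, integral_centredSq _ hr]

theorem sum_covariance_centredSq_le_variance (hr : 0 < r) (hf : Continuous f)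
    (Λ : Finset (Fin m)) :
    ∑ l ∈ Λ, cov[f, fun θ => centredSq (φ l) r (θ l); cubeUniform φ r] ^ 2 / (4 * r ^ 4 / 45)
      ≤ Var[f; cubeUniform φ r] := by
  have := isProbabilityMeasure_cubeUniform φ hr
  simpa only [variance_centredSq φ hr] using sum_covariance_sq_div_variance_le
    (g := fun l θ => centredSq (φ l) r (θ l)) (s := Λ) (memLp_two_cubeUniform φ hr hf)
    (fun l _ => memLp_two_cubeUniform φ hr (by fun_prop))
    fun l _ k _ hlk => covariance_centredSq_of_ne φ hr hlk

theorem abs_covariance_centredSq_sub_integral_le {l : Fin m} {B : ℝ} (hr : 0 < r)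
    (hf : Continuous f) (hpartial : Continuous (partialSq l f))
    (hslice : ∀ θ, ContDiff ℝ 4 fun t => f (Function.update θ l t))
    (hB : ∀ θ t, |iteratedDeriv 4 (fun s => f (Function.update θ l s)) t| ≤ B) :
    |cov[f, fun θ => centredSq (φ l) r (θ l); cubeUniform φ r]
        - 2 * r ^ 4 / 45 * ∫ θ, partialSq l f (Function.update θ l (φ l)) ∂cubeUniform φ r|
      ≤ r ^ 6 / 180 * B := by
  have := isProbabilityMeasure_cubeUniform φ hr
  have := fun i => isProbabilityMeasure_intervalUniform (φ i) hr
  have hinner : Integrable (fun θ => ∫ t, f (Function.update θ l t) * centredSq (φ l) r t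
      ∂intervalUniform (φ l) r) (cubeUniform φ r) := by
    have hint := integrable_cubeUniform φ hr (f := fun θ => f θ * centredSq (φ l) r (θ l))
      (by fun_prop)
    rw [cubeUniform_eq_pi φ hr] at hint ⊢
    simpa using integrable_integral_update hint l
  rw [covariance_centredSq φ hr hf, ← integral_const_mul,
    ← integral_sub hinner (integrable_cubeUniform φ hr (by fun_prop))]
  have hpointwise : ∀ θ, ‖∫ t, f (Function.update θ l t) * centredSq (φ l) r t
      ∂intervalUniform (φ l) r - 2 * r ^ 4 / 45 * partialSq l f (Function.update θ l (φ l))‖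
      ≤ r ^ 6 / 180 * B := fun θ => by
    rw [partialSq_update]
    exact abs_integral_mul_centredSq_sub_le hr (hslice θ) (hB θ)
  simpa using norm_integral_le_of_norm_le_const (μ := cubeUniform φ r) (ae_of_all _ hpointwise)

theorem abs_integral_update_sub_le {l : Fin m} {C : Fin m → ℝ} (hr : 0 < r)
    (hf : Continuous f)
    (hslice : ∀ μ θ, ContDiff ℝ 2 fun t => f (Function.update θ μ t))
    (hC : ∀ μ ≠ l, ∀ θ, (∀ i < μ, θ i = φ i) → |partialSq μ f θ| ≤ C μ) :
    |∫ θ, f (Function.update θ l (φ l)) ∂cubeUniform φ r - f φ|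
      ≤ r ^ 2 / 6 * ∑ μ ∈ Finset.univ.erase l, C μ := by
  have := fun i => isProbabilityMeasure_intervalUniform (φ i) hr
  have hstep : ∀ μ θ, (∀ i < μ, θ i = φ i) →
      ‖∫ t, f (Function.update (Function.update θ μ t) l (φ l)) ∂intervalUniform (φ μ) r
        - f (Function.update (Function.update θ μ (φ μ)) l (φ l))‖
      ≤ if μ = l then 0 else r ^ 2 / 6 * C μ := by
    intro μ θ hθ
    split_ifs with hμ
    · subst hμ
      simp
    simp only [fun t : ℝ => Function.update_comm hμ t (φ l) θ]
    refine abs_integral_intervalUniform_sub_le hr (hslice μ _) fun t => ?_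
    rw [← partialSq_update]
    refine hC μ hμ _ fun i hi => ?_
    rw [Function.update_of_ne hi.ne]
    rcases eq_or_ne i l with rfl | hil
    · simp
    · simpa [hil] using hθ i hi
  have hpiecewise : ∀ s : Finset (Fin m), Continuous fun θ : Fin m → ℝ => s.piecewise φ θ :=
    fun s => continuous_pi fun i => by
      unfold Finset.piecewise
      split_ifs
      exacts [continuous_const, continuous_apply i]
  have h := norm_integral_pi_sub_le_sum (F := fun θ => f (Function.update θ l (φ l))) (fun s => by
    rw [← cubeUniform_eq_pi φ hr]
    exact integrable_cubeUniform φ hr (hf.comp ((hpiecewise s).update l continuous_const))) hstep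
  rw [← cubeUniform_eq_pi φ hr, Function.update_eq_self, Finset.sum_ite, Finset.sum_const_zero,
    zero_add, ← Finset.mul_sum, Finset.filter_ne'] at h
  exact h

theorem abs_covariance_centredSq_sub_le {l : Fin m} {B : ℝ} {C : Fin m → ℝ} (hr : 0 < r)
    (hf : Continuous f) (hpartial : Continuous (partialSq l f))
    (hslice : ∀ θ, ContDiff ℝ 4 fun t => f (Function.update θ l t))
    (hB : ∀ θ t, |iteratedDeriv 4 (fun s => f (Function.update θ l s)) t| ≤ B)
    (hpslice : ∀ μ θ, ContDiff ℝ 2 fun t => partialSq l f (Function.update θ μ t))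
    (hC : ∀ μ ≠ l, ∀ θ, (∀ i < μ, θ i = φ i) → |partialSq μ (partialSq l f) θ| ≤ C μ) :
    |cov[f, fun θ => centredSq (φ l) r (θ l); cubeUniform φ r]
        - 2 * r ^ 4 / 45 * partialSq l f φ|
      ≤ 2 * r ^ 4 / 45 * (r ^ 2 / 6 * ∑ μ ∈ Finset.univ.erase l, C μ + r ^ 2 / 8 * B) := by
  have hoverlap := abs_covariance_centredSq_sub_integral_le φ hr hf hpartial hslice hB
  have hfreeze := abs_integral_update_sub_le φ hr hpartial hpslice hC
  have hscaled := mul_le_mul_of_nonneg_left hfreeze (by positivity : 0 ≤ 2 * r ^ 4 / 45)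
  rw [← abs_of_nonneg (by positivity : 0 ≤ 2 * r ^ 4 / 45), ← abs_mul,
    abs_of_nonneg (by positivity : 0 ≤ 2 * r ^ 4 / 45), mul_sub] at hscaled
  refine (abs_sub_le _ _ _).trans ((add_le_add hoverlap hscaled).trans_eq ?_)
  ring

end Cube

section Commutator

variable {A : Type*} [NormedRing A] (𝕜 : Type*) [NontriviallyNormedField 𝕜] [NormedAlgebra 𝕜 A]

/-- The commutator `x ↦ a x - x a` with a fixed element `a`, as a continuous linear map. -/
noncomputable def commutatorCLM (a : A) : A →L[𝕜] A :=
  ContinuousLinearMap.mul 𝕜 A a - (ContinuousLinearMap.mul 𝕜 A).flip a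

theorem commutatorCLM_apply (a x : A) : commutatorCLM 𝕜 a x = a * x - x * a := rfl

theorem commutatorCLM_pow_mul_mul {a v w : A} (hv : Commute a v) (hw : Commute a w) (j : ℕ)
    (x : A) : (commutatorCLM 𝕜 a ^ j) (v * x * w) = v * (commutatorCLM 𝕜 a ^ j) x * w := by
  induction j with
  | zero => rfl
  | succ j ih =>
    simp only [pow_succ', mul_apply_eq_comp, ih, commutatorCLM_apply]
    simp only [mul_sub, sub_mul, ← mul_assoc, hv.eq]
    simp only [mul_assoc, hw.eq]

theorem norm_commutatorCLM_apply_le {c : A} (hc : c ∈ Set.center A) (a x : A) :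
    ‖commutatorCLM 𝕜 a x‖ ≤ 2 * ‖a - c‖ * ‖x‖ :=
  calc ‖commutatorCLM 𝕜 a x‖ = ‖(a - c) * x - x * (a - c)‖ := by
        rw [commutatorCLM_apply, sub_mul, mul_sub, (Set.mem_center_iff.1 hc).comm x,
          sub_sub_sub_cancel_right]
    _ ≤ ‖a - c‖ * ‖x‖ + ‖x‖ * ‖a - c‖ :=
        (norm_sub_le _ _).trans (add_le_add (norm_mul_le _ _) (norm_mul_le _ _))
    _ = 2 * ‖a - c‖ * ‖x‖ := by ring

end Commutator

theorem norm_conjStarAlgAut {𝕜 A : Type*} [CommSemiring 𝕜] [NormedRing A] [StarRing A] [CStarRing A]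
    [Algebra 𝕜 A] (u : unitary A) (x : A) : ‖Unitary.conjStarAlgAut 𝕜 A u x‖ = ‖x‖ := by
  rw [Unitary.conjStarAlgAut_apply, CStarRing.norm_mul_mem_unitary _ (Unitary.star_mem u.2),
    CStarRing.norm_coe_unitary_mul]

section Matrix

variable {𝕜 ι : Type*} [RCLike 𝕜] [Fintype ι] [DecidableEq ι] {A : Matrix ι ι 𝕜}

theorem norm_conjTranspose_mul_mul_of_mem_unitaryGroup {W : Matrix ι ι 𝕜}
    (hW : W ∈ Matrix.unitaryGroup ι 𝕜) (X : Matrix ι ι 𝕜) : ‖Wᴴ * X * W‖ = ‖X‖ := by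
  have h := norm_conjStarAlgAut (𝕜 := 𝕜) (star (⟨W, hW⟩ : unitary (Matrix ι ι 𝕜))) X
  rwa [Unitary.conjStarAlgAut_star_apply] at h

theorem norm_sub_smul_one_of_isHermitian (hA : A.IsHermitian) (c : ℝ) :
    ‖A - (c : 𝕜) • (1 : Matrix ι ι 𝕜)‖ = ‖fun i => hA.eigenvalues i - c‖ := by
  set Φ := Unitary.conjStarAlgAut 𝕜 _ hA.eigenvectorUnitary
  have hdiag : A - (c : 𝕜) • (1 : Matrix ι ι 𝕜)
      = Φ (Matrix.diagonal fun i => (hA.eigenvalues i : 𝕜) - c) := by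
    rw [← Matrix.diagonal_sub, map_sub, ← Matrix.smul_one_eq_diagonal, map_smul, map_one]
    exact congrArg (· - _) hA.spectral_theorem
  rw [hdiag, norm_conjStarAlgAut, Matrix.l2_opNorm_diagonal]
  simp only [Pi.norm_def, ← RCLike.ofReal_sub, ← norm_toNNReal, RCLike.norm_ofReal,
    Real.norm_eq_abs]

theorem abs_eigenvalues_le_norm (hA : A.IsHermitian) (i : ι) : |hA.eigenvalues i| ≤ ‖A‖ := by
  have h := norm_sub_smul_one_of_isHermitian hA 0
  simp only [RCLike.ofReal_zero, zero_smul, sub_zero] at h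
  exact h ▸ norm_le_pi_norm hA.eigenvalues i

theorem norm_sub_midpoint_le_of_isHermitian [Nonempty ι] (hA : A.IsHermitian) :
    ‖A - ((((⨆ i, hA.eigenvalues i) + ⨅ i, hA.eigenvalues i) / 2 : ℝ) : 𝕜) • (1 : Matrix ι ι 𝕜)‖
      ≤ ((⨆ i, hA.eigenvalues i) - ⨅ i, hA.eigenvalues i) / 2 := by
  rw [norm_sub_smul_one_of_isHermitian hA]
  refine (pi_norm_le_iff_of_nonempty _).2 fun i => ?_
  have hmin := ciInf_le (f := hA.eigenvalues) (Set.finite_range _).bddBelow i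
  have hmax := le_ciSup (f := hA.eigenvalues) (Set.finite_range _).bddAbove i
  rw [Real.norm_eq_abs, abs_le]
  constructor <;> linarith

theorem norm_apply_le_l2_opNorm (X : Matrix ι ι 𝕜) (i j : ι) : ‖X i j‖ ≤ ‖X‖ := by
  have h := Matrix.l2_opNorm_mulVec X (EuclideanSpace.single j 1)
  rw [PiLp.norm_single, norm_one, mul_one] at h
  refine le_trans ?_ h
  simpa using PiLp.norm_apply_le (WithLp.toLp 2 (X *ᵥ (EuclideanSpace.single j (1 : 𝕜)).ofLp)) i

theorem norm_trace_mul_le_of_posSemidef (hA : A.PosSemidef) (X : Matrix ι ι 𝕜) :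
    ‖(A * X).trace‖ ≤ RCLike.re A.trace * ‖X‖ := by
  set Φ := Unitary.conjStarAlgAut 𝕜 _ hA.1.eigenvectorUnitary
  have htrace : (A * X).trace = ∑ i, (hA.1.eigenvalues i : 𝕜) * Φ.symm X i i := by
    have htraceΦ (Y : Matrix ι ι 𝕜) : (Φ Y).trace = Y.trace := by
      rw [Unitary.conjStarAlgAut_apply, Matrix.trace_mul_cycle, Unitary.coe_star_mul_self, one_mul]
    calc (A * X).trace
        = (Φ (Matrix.diagonal fun i => (hA.1.eigenvalues i : 𝕜)) * Φ (Φ.symm X)).trace := by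
          rw [Φ.apply_symm_apply]
          exact congrArg (fun B => (B * X).trace) hA.1.spectral_theorem
      _ = ∑ i, (hA.1.eigenvalues i : 𝕜) * Φ.symm X i i := by
          rw [← map_mul, htraceΦ]
          simp only [Matrix.trace, Matrix.diag_apply, Matrix.diagonal_mul]
  have hnorm : ‖Φ.symm X‖ = ‖X‖ := by
    rw [← norm_conjStarAlgAut (𝕜 := 𝕜) hA.1.eigenvectorUnitary (Φ.symm X)]
    exact congrArg _ (Φ.apply_symm_apply X)
  calc ‖(A * X).trace‖ ≤ ∑ i, hA.1.eigenvalues i * ‖X‖ := by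
        refine htrace ▸ norm_sum_le_of_le _ fun i _ => ?_
        rw [norm_mul, RCLike.norm_of_nonneg (hA.eigenvalues_nonneg i)]
        refine mul_le_mul_of_nonneg_left ?_ (hA.eigenvalues_nonneg i)
        exact (norm_apply_le_l2_opNorm _ i i).trans_eq hnorm
    _ = RCLike.re A.trace * ‖X‖ := by
        rw [← Finset.sum_mul, hA.1.trace_eq_sum_eigenvalues, map_sum]
        simp only [RCLike.ofReal_re]

end Matrix

section MaxFreq

variable {n : ℕ} {H : QOp n}

theorem maxFreqOf_nonneg (hH : H.IsHermitian) : 0 ≤ maxFreqOf hH := by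
  have := (norm_nonneg _).trans (norm_sub_midpoint_le_of_isHermitian hH)
  unfold maxFreqOf
  linarith

theorem maxFreqOf_le (hH : H.IsHermitian) : maxFreqOf hH ≤ 2 * ‖H‖ := by
  have hmax : (⨆ i, hH.eigenvalues i) ≤ ‖H‖ :=
    ciSup_le fun i => (le_abs_self _).trans (abs_eigenvalues_le_norm hH i)
  have hmin : -‖H‖ ≤ ⨅ i, hH.eigenvalues i :=
    le_ciInf fun i => (abs_le.1 (abs_eigenvalues_le_norm hH i)).1
  unfold maxFreqOf
  linarith

theorem norm_commutatorCLM_I_smul_le (hH : H.IsHermitian) (X : QOp n) :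
    ‖commutatorCLM ℝ (Complex.I • H) X‖ ≤ maxFreqOf hH * ‖X‖ := by
  set c : ℂ := ((((⨆ i, hH.eigenvalues i) + ⨅ i, hH.eigenvalues i) / 2 : ℝ) : ℂ)
  have hcenter : Complex.I • c • (1 : QOp n) ∈ Set.center (QOp n) := by
    rw [smul_smul, ← Algebra.algebraMap_eq_smul_one]
    exact Set.algebraMap_mem_center _
  have hnorm : ‖Complex.I • H - Complex.I • c • (1 : QOp n)‖ ≤ maxFreqOf hH / 2 := by
    rw [← smul_sub, norm_smul, Complex.norm_I, one_mul]
    exact norm_sub_midpoint_le_of_isHermitian hH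
  refine (norm_commutatorCLM_apply_le ℝ hcenter _ X).trans ?_
  exact mul_le_mul_of_nonneg_right (by linarith) (norm_nonneg X)

theorem norm_commutatorCLM_I_smul_pow_le (hH : H.IsHermitian) (s : ℕ) (X : QOp n) :
    ‖(commutatorCLM ℝ (Complex.I • H) ^ s) X‖ ≤ maxFreqOf hH ^ s * ‖X‖ := by
  induction s with
  | zero => simp
  | succ s ih =>
    rw [pow_succ', mul_apply_eq_comp, pow_succ', mul_assoc]
    exact (norm_commutatorCLM_I_smul_le hH _).trans
      (mul_le_mul_of_nonneg_left ih (maxFreqOf_nonneg hH))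

end MaxFreq

section DerivativeFamily

variable {m : ℕ} {E : Type*} [NormedAddCommGroup E] [NormedSpace ℝ E]

/-- `D j` plays the role of the `j`-th mixed partial derivative of `D 0`: increasing the
multi-index `j` by one in the direction `l` differentiates along the `l`-th coordinate. -/
def IsDerivativeFamily (D : (Fin m → ℕ) → (Fin m → ℝ) → E) : Prop :=
  ∀ j l θ t, HasDerivAt (fun t => D j (Function.update θ l t))
    (D (j + Pi.single l 1) (Function.update θ l t)) t

namespace IsDerivativeFamily

variable {D : (Fin m → ℕ) → (Fin m → ℝ) → E} (hD : IsDerivativeFamily D)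
include hD

theorem hasDerivAt_add_single (j : Fin m → ℕ) (l : Fin m) (θ : Fin m → ℝ) (i : ℕ) (t : ℝ) :
    HasDerivAt (fun t => D (j + Pi.single l i) (Function.update θ l t))
      (D (j + Pi.single l (i + 1)) (Function.update θ l t)) t := by
  rw [Pi.single_add, ← add_assoc]
  exact hD _ l θ t

theorem contDiff_update (j : Fin m → ℕ) (l : Fin m) (θ : Fin m → ℝ) (k : ℕ∞) :
    ContDiff ℝ k fun t => D j (Function.update θ l t) := by
  simpa using contDiff_of_hasDerivAt_succ (hD.hasDerivAt_add_single j l θ) k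

theorem iteratedDeriv_update (j : Fin m → ℕ) (l : Fin m) (θ : Fin m → ℝ) (i : ℕ) :
    iteratedDeriv i (fun t => D j (Function.update θ l t))
      = fun t => D (j + Pi.single l i) (Function.update θ l t) := by
  simpa using iteratedDeriv_of_hasDerivAt_succ (hD.hasDerivAt_add_single j l θ) i

theorem partialSq_eq (j : Fin m → ℕ) (l : Fin m) : partialSq l (D j) = D (j + Pi.single l 2) := by
  ext θ
  simp only [partialSq, hD.iteratedDeriv_update, Function.update_eq_self]

end IsDerivativeFamily

end DerivativeFamily

namespace VarProblem

variable {n m : ℕ} (P : VarProblem n m)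

theorem conjTranspose_exp_gen (l : Fin m) (t : ℝ) :
    (NormedSpace.exp ((-(Complex.I * (t : ℂ))) • P.gen l))ᴴ
      = NormedSpace.exp (t • (Complex.I • P.gen l)) := by
  rw [← Matrix.exp_conjTranspose, Matrix.conjTranspose_smul, (P.gen_isHermitian l).eq,
    ← Complex.coe_smul, smul_smul]
  simp [mul_comm]

theorem exp_gen_eq (l : Fin m) (t : ℝ) :
    NormedSpace.exp ((-(Complex.I * (t : ℂ))) • P.gen l)
      = NormedSpace.exp (t • (-(Complex.I • P.gen l))) := by
  rw [← Complex.coe_smul, smul_neg, smul_smul, neg_smul, mul_comm]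

theorem exp_gen_mem_unitaryGroup (l : Fin m) (t : ℝ) :
    NormedSpace.exp ((-(Complex.I * (t : ℂ))) • P.gen l) ∈ Matrix.unitaryGroup (Qubits n) ℂ := by
  rw [Matrix.mem_unitaryGroup_iff', Matrix.star_eq_conjTranspose, conjTranspose_exp_gen,
    exp_gen_eq, smul_neg,
    ← Matrix.exp_add_of_commute _ _ (Commute.refl (t • Complex.I • P.gen l)).neg_right,
    add_neg_cancel, NormedSpace.exp_zero]

theorem gate_mem_unitaryGroup (l : Fin m) (t : ℝ) :
    P.gate l t ∈ Matrix.unitaryGroup (Qubits n) ℂ :=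
  mul_mem (P.fixedGate_unitary l) (P.exp_gen_mem_unitaryGroup l t)

/-- The derivation `X ↦ i [H_l, X]`, which generates the conjugation by the `l`-th rotation. -/
noncomputable def adGen (l : Fin m) : QOp n →L[ℝ] QOp n :=
  commutatorCLM ℝ (Complex.I • P.gen l)

/-- The back-propagation `X ↦ G† X G` of an operator through the rotated gate
`G = V_l e^{-i t H_l}`. -/
noncomputable def gateConj (l : Fin m) (t : ℝ) (X : QOp n) : QOp n :=
  (P.gate l t)ᴴ * X * P.gate l t

theorem norm_gateConj (l : Fin m) (t : ℝ) (X : QOp n) : ‖P.gateConj l t X‖ = ‖X‖ :=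
  norm_conjTranspose_mul_mul_of_mem_unitaryGroup (P.gate_mem_unitaryGroup l t) X

-- The rotation commutes with its own generator, so it can be pulled out of the commutators.
theorem norm_adGen_pow_gateConj (l : Fin m) (s : ℕ) (t : ℝ) (X : QOp n) :
    ‖(P.adGen l ^ s) (P.gateConj l t X)‖
      = ‖(P.adGen l ^ s) ((P.fixedGate l)ᴴ * X * P.fixedGate l)‖ := by
  set E := NormedSpace.exp ((-(Complex.I * (t : ℂ))) • P.gen l) with hE
  have hcomm : Commute (Complex.I • P.gen l) E := by
    rw [hE, exp_gen_eq]
    exact ((Commute.refl _).neg_right.smul_right t).exp_right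
  have hcomm' : Commute (Complex.I • P.gen l) Eᴴ := by
    rw [hE, conjTranspose_exp_gen]
    exact ((Commute.refl _).smul_right t).exp_right
  have hsplit : P.gateConj l t X = Eᴴ * ((P.fixedGate l)ᴴ * X * P.fixedGate l) * E := by
    simp only [gateConj, gate, Matrix.conjTranspose_mul, mul_assoc, hE]
  rw [hsplit, adGen, commutatorCLM_pow_mul_mul ℝ hcomm' hcomm,
    norm_conjTranspose_mul_mul_of_mem_unitaryGroup (P.exp_gen_mem_unitaryGroup l t)]

theorem hasDerivAt_gate (l : Fin m) (t : ℝ) :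
    HasDerivAt (P.gate l) (P.gate l t * -(Complex.I • P.gen l)) t := by
  unfold gate
  simp only [exp_gen_eq, mul_assoc]
  exact (hasDerivAt_exp_smul_const (𝕂 := ℝ) (-(Complex.I • P.gen l)) t).const_mul _

theorem hasDerivAt_conjTranspose_gate (l : Fin m) (t : ℝ) :
    HasDerivAt (fun t => (P.gate l t)ᴴ) ((Complex.I • P.gen l) * (P.gate l t)ᴴ) t := by
  unfold gate
  simp only [Matrix.conjTranspose_mul, conjTranspose_exp_gen, ← mul_assoc]
  exact (hasDerivAt_exp_smul_const' (𝕂 := ℝ) (Complex.I • P.gen l) t).mul_const _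

theorem hasDerivAt_gateConj (l : Fin m) (X : QOp n) (t : ℝ) :
    HasDerivAt (fun t => P.gateConj l t X) (P.adGen l (P.gateConj l t X)) t := by
  refine (((P.hasDerivAt_conjTranspose_gate l t).mul_const X).mul
    (P.hasDerivAt_gate l t)).congr_deriv ?_
  simp only [adGen, gateConj, commutatorCLM_apply, mul_assoc, mul_neg, sub_eq_add_neg]

theorem continuous_gate (l : Fin m) : Continuous (P.gate l) :=
  continuous_iff_continuousAt.2 fun t => (P.hasDerivAt_gate l t).continuousAt

/-- The observable back-propagated through the first `k` gates, differentiated `j l` times with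
respect to each parameter `θ l` on the way. -/
noncomputable def jet (j : Fin m → ℕ) (θ : Fin m → ℝ) : Fin (m + 1) → QOp n :=
  Fin.induction P.obs fun l X => (P.adGen l ^ j l) (P.gateConj l (θ l) X)

theorem jet_zero (j : Fin m → ℕ) (θ : Fin m → ℝ) : P.jet j θ 0 = P.obs := rfl

theorem jet_succ (j : Fin m → ℕ) (θ : Fin m → ℝ) (l : Fin m) :
    P.jet j θ l.succ = (P.adGen l ^ j l) (P.gateConj l (θ l) (P.jet j θ l.castSucc)) := rfl

theorem jet_congr {j j' : Fin m → ℕ} {θ θ' : Fin m → ℝ} {k : Fin (m + 1)}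
    (hj : ∀ i : Fin m, i.castSucc < k → j i = j' i)
    (hθ : ∀ i : Fin m, i.castSucc < k → θ i = θ' i) : P.jet j θ k = P.jet j' θ' k := by
  induction k using Fin.induction with
  | zero => rfl
  | succ l ih =>
    have hl := Fin.castSucc_lt_succ (i := l)
    rw [jet_succ, jet_succ, hj l hl, hθ l hl,
      ih (fun i hi => hj i (hi.trans hl)) fun i hi => hθ i (hi.trans hl)]

theorem continuous_jet (j : Fin m → ℕ) (k : Fin (m + 1)) : Continuous fun θ => P.jet j θ k := by
  induction k using Fin.induction with
  | zero => exact continuous_const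
  | succ l ih =>
    have hgate : Continuous fun θ : Fin m → ℝ => P.gate l (θ l) :=
      (P.continuous_gate l).comp (continuous_apply l)
    exact (P.adGen l ^ j l).continuous.comp ((hgate.matrix_conjTranspose.mul ih).mul hgate)

theorem hasDerivAt_jet (j : Fin m → ℕ) (l : Fin m) (θ : Fin m → ℝ) {k : Fin (m + 1)}
    (hk : l.castSucc < k) (t : ℝ) :
    HasDerivAt (fun t => P.jet j (Function.update θ l t) k)
      (P.jet (j + Pi.single l 1) (Function.update θ l t) k) t := by
  induction k using Fin.induction with
  | zero => exact absurd hk (Fin.not_lt_zero _)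
  | succ i ih =>
    rcases eq_or_ne i l with rfl | hil
    · have hfrozen (j' : Fin m → ℕ) (hj' : ∀ i' < i, j' i' = j i') (s : ℝ) :
          P.jet j' (Function.update θ i s) i.castSucc = P.jet j θ i.castSucc :=
        P.jet_congr (fun i' hi' => hj' i' hi')
          fun i' hi' => Function.update_of_ne (Fin.castSucc_lt_castSucc_iff.1 hi').ne _ _
      have hadd : ∀ i' < i, (j + Pi.single i 1 : Fin m → ℕ) i' = j i' := fun i' hi' => by
        simp [hi'.ne]
      simp only [jet_succ, Function.update_self, hfrozen j (fun _ _ => rfl), hfrozen _ hadd,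
        Pi.add_apply, Pi.single_eq_same, pow_succ]
      exact (P.adGen i ^ j i).hasFDerivAt.comp_hasDerivAt t (P.hasDerivAt_gateConj i _ t)
    · have hlt : l.castSucc < i.castSucc :=
        Fin.castSucc_lt_castSucc_iff.2 ((Fin.castSucc_lt_succ_iff.1 hk).lt_of_ne hil.symm)
      have hconj := ((ih hlt).const_mul (P.gate i (θ i))ᴴ).mul_const (P.gate i (θ i))
      simp only [jet_succ, Function.update_of_ne hil, Pi.add_apply, Pi.single_eq_of_ne hil,
        add_zero]
      exact (P.adGen i ^ j i).hasFDerivAt.comp_hasDerivAt t hconj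

theorem norm_jet_of_le {j : Fin m → ℕ} (θ : Fin m → ℝ) {k k' : Fin (m + 1)} (hk : k ≤ k')
    (hj : ∀ i : Fin m, k ≤ i.castSucc → j i = 0) : ‖P.jet j θ k'‖ = ‖P.jet j θ k‖ := by
  induction k' using Fin.induction with
  | zero => rw [Fin.le_zero_iff.1 hk]
  | succ l ih =>
    rcases hk.eq_or_lt with rfl | hlt
    · rfl
    · have hl : k ≤ l.castSucc := Fin.le_castSucc_iff.2 hlt
      rw [jet_succ, hj l hl, pow_zero, one_apply_eq_self, norm_gateConj, ih hl]

theorem jet_zero_last (θ : Fin m → ℝ) : P.jet 0 θ (Fin.last m) = P.heisenberg θ := by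
  have hprefix (k : Fin (m + 1)) : P.jet 0 θ k
      = (((List.ofFn fun l => P.gate l (θ l)).take k).prod)ᴴ * P.obs
        * ((List.ofFn fun l => P.gate l (θ l)).take k).prod := by
    induction k using Fin.induction with
    | zero => simp [jet_zero]
    | succ l ih =>
      rw [Fin.val_succ, List.prod_take_succ _ _ (by simp), Matrix.conjTranspose_mul, jet_succ, ih,
        Pi.zero_apply, pow_zero, one_apply_eq_self]
      simp only [gateConj, List.getElem_ofFn, Fin.val_castSucc, mul_assoc]
  rw [hprefix, List.take_of_length_le (by simp)]
  rfl

/-- The mixed partial derivative of `U(θ)† O U(θ)` of multi-index `j`. -/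
noncomputable def heisenbergDeriv (j : Fin m → ℕ) (θ : Fin m → ℝ) : QOp n :=
  P.jet j θ (Fin.last m)

theorem heisenbergDeriv_zero : P.heisenbergDeriv 0 = P.heisenberg := funext P.jet_zero_last

theorem continuous_heisenbergDeriv (j : Fin m → ℕ) : Continuous (P.heisenbergDeriv j) :=
  P.continuous_jet j _

theorem isDerivativeFamily_heisenbergDeriv : IsDerivativeFamily P.heisenbergDeriv :=
  fun j l θ t => P.hasDerivAt_jet j l θ (Fin.castSucc_lt_last l) t

theorem norm_heisenbergDeriv_eq_norm_jet {j : Fin m → ℕ} {l : Fin m} (hj : ∀ i, l < i → j i = 0)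
    (θ : Fin m → ℝ) : ‖P.heisenbergDeriv j θ‖ = ‖P.jet j θ l.succ‖ :=
  P.norm_jet_of_le θ (Fin.le_last _) fun i hi => hj i (Fin.succ_le_castSucc_iff.1 hi)

theorem norm_heisenbergDeriv_congr {j : Fin m → ℕ} {θ θ' : Fin m → ℝ} {l : Fin m}
    (hj : ∀ i, l < i → j i = 0) (hθ : ∀ i < l, θ i = θ' i) :
    ‖P.heisenbergDeriv j θ‖ = ‖P.heisenbergDeriv j θ'‖ := by
  simp only [P.norm_heisenbergDeriv_eq_norm_jet hj, jet_succ, norm_adGen_pow_gateConj]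
  rw [P.jet_congr (fun _ _ => rfl) hθ]

theorem norm_heisenbergDeriv_add_single_le {j : Fin m → ℕ} {l : Fin m} (hj : ∀ i, l < i → j i = 0)
    (s : ℕ) (θ : Fin m → ℝ) : ‖P.heisenbergDeriv (j + Pi.single l s) θ‖
      ≤ P.maxFreq l ^ s * ‖P.heisenbergDeriv j θ‖ := by
  have hj' : ∀ i, l < i → (j + Pi.single l s : Fin m → ℕ) i = 0 := fun i hi => by
    simp [hj i hi, hi.ne']
  have hprefix : P.jet (j + Pi.single l s) θ l.castSucc = P.jet j θ l.castSucc :=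
    P.jet_congr (fun i hi => by simp [(Fin.castSucc_lt_castSucc_iff.1 hi).ne])
      fun _ _ => rfl
  rw [P.norm_heisenbergDeriv_eq_norm_jet hj, P.norm_heisenbergDeriv_eq_norm_jet hj', jet_succ,
    jet_succ, hprefix, Pi.add_apply, Pi.single_eq_same, add_comm, pow_add, mul_apply_eq_comp]
  exact norm_commutatorCLM_I_smul_pow_le (P.gen_isHermitian l) s _

theorem norm_heisenbergDeriv_zero (θ : Fin m → ℝ) : ‖P.heisenbergDeriv 0 θ‖ = ‖P.obs‖ :=
  (P.norm_jet_of_le (k := 0) θ (Fin.zero_le _) fun _ _ => rfl).trans (congrArg _ (P.jet_zero 0 θ))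

theorem abs_re_trace_state_mul_le (X : QOp n) : |(P.state * X).trace.re| ≤ ‖X‖ := by
  have h := norm_trace_mul_le_of_posSemidef P.state_posSemidef X
  rw [P.state_trace, RCLike.one_re, one_mul] at h
  exact (Complex.abs_re_le_norm _).trans h

/-- The functional `X ↦ Re Tr[ρ X]`, the expectation value in the input state. -/
noncomputable def expectation : QOp n →L[ℝ] ℝ :=
  (Complex.reLm ∘ₗ Matrix.traceLinearMap (Qubits n) ℝ ℂ ∘ₗ LinearMap.mulLeft ℝ P.state).mkContinuous
    1 fun X => (P.abs_re_trace_state_mul_le X).trans_eq (one_mul _).symm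

/-- The mixed partial derivative of the loss of multi-index `j`. -/
noncomputable def lossDeriv (j : Fin m → ℕ) (θ : Fin m → ℝ) : ℝ :=
  P.expectation (P.heisenbergDeriv j θ)

theorem lossDeriv_zero : P.lossDeriv 0 = P.loss := by
  ext θ
  rw [lossDeriv, heisenbergDeriv_zero, loss, mul_assoc, mul_assoc, Matrix.trace_mul_comm]
  change (P.state * P.heisenberg θ).trace.re = _
  simp only [heisenberg, mul_assoc]

theorem continuous_lossDeriv (j : Fin m → ℕ) : Continuous (P.lossDeriv j) :=
  P.expectation.continuous.comp (P.continuous_heisenbergDeriv j)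

theorem isDerivativeFamily_lossDeriv : IsDerivativeFamily P.lossDeriv := fun j l θ t =>
  P.expectation.hasFDerivAt.comp_hasDerivAt t (P.isDerivativeFamily_heisenbergDeriv j l θ t)

theorem abs_lossDeriv_le (j : Fin m → ℕ) (θ : Fin m → ℝ) :
    |P.lossDeriv j θ| ≤ ‖P.heisenbergDeriv j θ‖ :=
  P.abs_re_trace_state_mul_le _

theorem partialSq_loss (l : Fin m) : partialSq l P.loss = P.lossDeriv (Pi.single l 2) := by
  rw [← lossDeriv_zero, P.isDerivativeFamily_lossDeriv.partialSq_eq, zero_add]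

theorem effFreq_sq (φ : Fin m → ℝ) (μ : Fin m) :
    P.effFreq φ μ ^ 2 = ‖P.heisenbergDeriv (Pi.single μ 2) φ‖ := by
  rw [effFreq, Real.sq_sqrt (norm_nonneg _), ← heisenbergDeriv_zero,
    P.isDerivativeFamily_heisenbergDeriv.partialSq_eq, zero_add]

theorem effFreq₂_sq (φ : Fin m → ℝ) (l μ : Fin m) :
    P.effFreq₂ φ l μ ^ 2 = ‖P.heisenbergDeriv (Pi.single l 2 + Pi.single μ 2) φ‖ := by
  rw [effFreq₂, Real.sq_sqrt (norm_nonneg _), ← heisenbergDeriv_zero,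
    P.isDerivativeFamily_heisenbergDeriv.partialSq_eq,
    P.isDerivativeFamily_heisenbergDeriv.partialSq_eq, zero_add]

end VarProblem

theorem sq_sub_two_mul_le_sq_of_abs_sub_le {x y a e : ℝ} (h : |y - x| ≤ a + e) (ha : a ≤ |x|) :
    (|x| - a) ^ 2 - 2 * (|x| - a) * e ≤ y ^ 2 := by
  have hy : |x| - a - e ≤ |y| := by
    have := abs_sub_abs_le_abs_sub x y
    rw [abs_sub_comm] at this
    linarith
  rw [← sq_abs y]
  rcases le_total e (|x| - a) with hle | hle
  · nlinarith [abs_nonneg y, sq_nonneg e]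
  · nlinarith [sq_nonneg |y|]

namespace VarProblem

variable {n m : ℕ} (P : VarProblem n m) (φ : Fin m → ℝ)

section Variance

theorem maxFreq_nonneg (l : Fin m) : 0 ≤ P.maxFreq l := maxFreqOf_nonneg _

theorem curv_nonneg (l : Fin m) : 0 ≤ P.curv φ l := abs_nonneg _

theorem freqSum_nonneg (l : Fin m) : 0 ≤ P.freqSum φ l := by
  unfold freqSum
  positivity

theorem beta_nonneg (l : Fin m) : 0 ≤ P.beta φ l := by
  have := P.maxFreq_nonneg l
  unfold beta
  split_ifs <;> positivity

theorem norm_heisenbergDeriv_single_two_le (l : Fin m) (θ : Fin m → ℝ) :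
    ‖P.heisenbergDeriv (Pi.single l 2) θ‖ ≤ P.maxFreq l ^ 2 * ‖P.obs‖ := by
  have h := P.norm_heisenbergDeriv_add_single_le (j := 0) (l := l) (fun _ _ => rfl) 2 θ
  rwa [zero_add, norm_heisenbergDeriv_zero] at h

theorem exists_norm_heisenbergDeriv_single_two_le (l : Fin m) :
    ∃ K, (∀ θ, ‖P.heisenbergDeriv (Pi.single l 2) θ‖ ≤ K) ∧
      P.maxFreq l ^ 2 * K ^ 2 ≤ 4 * P.beta φ l := by
  by_cases hl : (l : ℕ) = 0
  · refine ⟨P.effFreq φ l ^ 2, fun θ => ?_, ?_⟩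
    · rw [effFreq_sq]
      exact (P.norm_heisenbergDeriv_congr (fun i hi => Pi.single_eq_of_ne hi.ne' 2)
        fun i hi => by have := Fin.lt_def.1 hi; omega).le
    · rw [beta, if_pos hl]
      nlinarith [sq_nonneg (P.maxFreq l * P.effFreq φ l ^ 2)]
  · refine ⟨P.maxFreq l ^ 2 * ‖P.obs‖, P.norm_heisenbergDeriv_single_two_le l, ?_⟩
    rw [beta, if_neg hl]
    nlinarith [sq_nonneg (P.maxFreq l ^ 3 * ‖P.obs‖)]

variable {φ} in
theorem abs_lossDeriv_single_add_single_le {l μ : Fin m} (hμ : μ ≠ l) {θ : Fin m → ℝ}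
    (hθ : ∀ i < μ, θ i = φ i) : |P.lossDeriv (Pi.single l 2 + Pi.single μ 2) θ|
      ≤ if μ < l then P.maxFreq l ^ 2 * P.effFreq φ μ ^ 2 else P.effFreq₂ φ l μ ^ 2 := by
  refine (P.abs_lossDeriv_le _ θ).trans ?_
  split_ifs with hlt
  · have hsingle : ∀ i, μ < i → (Pi.single μ 2 : Fin m → ℕ) i = 0 := fun i hi =>
      Pi.single_eq_of_ne hi.ne' 2
    rw [add_comm, effFreq_sq, ← P.norm_heisenbergDeriv_congr hsingle hθ]
    exact P.norm_heisenbergDeriv_add_single_le (fun i hi => hsingle i (hlt.trans hi)) 2 θ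
  · have hlμ : l < μ := (not_lt.1 hlt).lt_of_ne hμ.symm
    rw [effFreq₂_sq]
    exact (P.norm_heisenbergDeriv_congr (l := μ)
      (fun i hi => by simp [hi.ne', (hlμ.trans hi).ne']) hθ).le

theorem sum_erase_le_freqSum (l : Fin m) :
    ∑ μ ∈ Finset.univ.erase l,
      (if μ < l then P.maxFreq l ^ 2 * P.effFreq φ μ ^ 2 else P.effFreq₂ φ l μ ^ 2)
      ≤ P.freqSum φ l := by
  have hlt : (Finset.univ.erase l).filter (· < l) = Finset.Iio l := by
    ext
    simp +contextual [ne_of_lt]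
  have hgt : (Finset.univ.erase l).filter (¬ · < l) = Finset.Ioi l := by
    ext μ
    simp only [Finset.mem_filter, Finset.mem_erase, Finset.mem_univ, Finset.mem_Ioi]
    grind
  rw [Finset.sum_ite, hlt, hgt, ← Finset.mul_sum, freqSum]
  gcongr
  nlinarith [sq_nonneg (P.maxFreq l)]

variable {r : ℝ}

theorem abs_covariance_loss_centredSq_sub_le (hr : 0 < r) {l : Fin m} {K : ℝ}
    (hK : ∀ θ, ‖P.heisenbergDeriv (Pi.single l 2) θ‖ ≤ K) :
    |cov[P.loss, fun θ => centredSq (φ l) r (θ l); cubeUniform φ r]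
        - 2 * r ^ 4 / 45 * partialSq l P.loss φ|
      ≤ 2 * r ^ 4 / 45 * (1 / 6 * P.freqSum φ l * r ^ 2 + r ^ 2 / 8 * (P.maxFreq l ^ 2 * K)) := by
  have hD := P.isDerivativeFamily_lossDeriv
  have hfourth (θ : Fin m → ℝ) (t : ℝ) :
      |iteratedDeriv 4 (fun s => P.lossDeriv 0 (Function.update θ l s)) t|
        ≤ P.maxFreq l ^ 2 * K := by
    rw [hD.iteratedDeriv_update, zero_add, Pi.single_add l 2 2]
    refine (P.abs_lossDeriv_le _ _).trans ?_
    exact (P.norm_heisenbergDeriv_add_single_le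
      (fun i hi => Pi.single_eq_of_ne hi.ne' 2) 2 _).trans
        (mul_le_mul_of_nonneg_left (hK _) (sq_nonneg _))
  have hmixed : ∀ μ ≠ l, ∀ θ : Fin m → ℝ, (∀ i < μ, θ i = φ i) →
      |partialSq μ (partialSq l (P.lossDeriv 0)) θ| ≤
        if μ < l then P.maxFreq l ^ 2 * P.effFreq φ μ ^ 2 else P.effFreq₂ φ l μ ^ 2 := by
    intro μ hμ θ hθ
    rw [hD.partialSq_eq, hD.partialSq_eq, zero_add]
    exact P.abs_lossDeriv_single_add_single_le hμ hθ
  have hpartial := hD.partialSq_eq 0 l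
  rw [← lossDeriv_zero]
  refine (abs_covariance_centredSq_sub_le φ hr (P.continuous_lossDeriv 0)
    (hpartial ▸ P.continuous_lossDeriv _) (fun θ => hD.contDiff_update 0 l θ 4) hfourth
    (fun μ θ => hpartial ▸ hD.contDiff_update _ μ θ 2) hmixed).trans ?_
  have hsum := (mul_le_mul_of_nonneg_left (P.sum_erase_le_freqSum φ l)
    (by positivity : 0 ≤ r ^ 2 / 6)).trans_eq
      (by ring : _ = 1 / 6 * P.freqSum φ l * r ^ 2)
  exact mul_le_mul_of_nonneg_left (by linarith) (by positivity)

theorem le_covariance_loss_centredSq_sq_div (hr : 0 < r) {l : Fin m}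
    (hl : 1 / 6 * P.freqSum φ l * r ^ 2 ≤ P.curv φ l) :
    r ^ 4 / 45 * ((P.curv φ l - 1 / 6 * P.freqSum φ l * r ^ 2) ^ 2 - P.beta φ l * r ^ 2)
      ≤ cov[P.loss, fun θ => centredSq (φ l) r (θ l); cubeUniform φ r] ^ 2 / (4 * r ^ 4 / 45) := by
  obtain ⟨K, hK, hβ⟩ := P.exists_norm_heisenbergDeriv_single_two_le φ l
  have hcov := P.abs_covariance_loss_centredSq_sub_le φ hr hK
  set b := cov[P.loss, fun θ => centredSq (φ l) r (θ l); cubeUniform φ r]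
  set α := 1 / 6 * P.freqSum φ l * r ^ 2
  have hα : 0 ≤ α := by have := P.freqSum_nonneg φ l; positivity
  obtain ⟨y, hy⟩ : ∃ y, b = 2 * r ^ 4 / 45 * y := ⟨b / (2 * r ^ 4 / 45), by field_simp⟩
  rw [hy, ← mul_sub, abs_mul, abs_of_pos (by positivity : 0 < 2 * r ^ 4 / 45),
    mul_le_mul_iff_right₀ (by positivity)] at hcov
  have hsq := sq_sub_two_mul_le_sq_of_abs_sub_le hcov hl
  have hcurv : P.curv φ l ≤ K := by
    rw [curv, partialSq_loss]
    exact (P.abs_lossDeriv_le _ _).trans (hK φ)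
  have herror : 2 * (P.curv φ l - α) * (r ^ 2 / 8 * (P.maxFreq l ^ 2 * K)) ≤ P.beta φ l * r ^ 2 :=
    calc 2 * (P.curv φ l - α) * (r ^ 2 / 8 * (P.maxFreq l ^ 2 * K))
        ≤ 2 * K * (r ^ 2 / 8 * (P.maxFreq l ^ 2 * K)) := by
          have := (P.curv_nonneg φ l).trans hcurv
          gcongr
          linarith
      _ = P.maxFreq l ^ 2 * K ^ 2 * (r ^ 2 / 4) := by ring
      _ ≤ 4 * P.beta φ l * (r ^ 2 / 4) := by gcongr
      _ = P.beta φ l * r ^ 2 := by ring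
  calc r ^ 4 / 45 * ((P.curv φ l - α) ^ 2 - P.beta φ l * r ^ 2) ≤ r ^ 4 / 45 * y ^ 2 := by
        gcongr
        exact (sub_le_sub_left herror _).trans hsq
    _ = b ^ 2 / (4 * r ^ 4 / 45) := by rw [hy]; field_simp; ring

theorem sum_le_lossVar (hr : 0 < r) {Λ : Finset (Fin m)}
    (hΛ : ∀ l ∈ Λ, 1 / 6 * P.freqSum φ l * r ^ 2 ≤ P.curv φ l) :
    ∑ l ∈ Λ, r ^ 4 / 45 *
        ((P.curv φ l - 1 / 6 * P.freqSum φ l * r ^ 2) ^ 2 - P.beta φ l * r ^ 2)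
      ≤ P.lossVar φ r :=
  have hloss : Continuous P.loss := P.lossDeriv_zero ▸ P.continuous_lossDeriv 0
  (Finset.sum_le_sum fun l hl => P.le_covariance_loss_centredSq_sq_div φ hr (hΛ l hl)).trans
    (sum_covariance_centredSq_le_variance φ hr hloss Λ)

end Variance

section Patch

variable {φ} {r : ℝ} {l : Fin m}

/-- The cross-multiplied form of `r² ≤ rPatchSqAt φ l`, together with `c_l(φ) ≠ 0`. -/
def InPatch (φ : Fin m → ℝ) (l : Fin m) (r : ℝ) : Prop :=
  0 < P.curv φ l ∧
    r ^ 2 * (8 * P.curv φ l * P.freqSum φ l + 24 * P.beta φ l) ≤ 9 * P.curv φ l ^ 2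

variable {P}

theorem inPatch_of_sq_le_rPatchSqAt (hr : 0 < r) (h : r ^ 2 ≤ P.rPatchSqAt φ l) :
    P.InPatch φ l r := by
  have hpos : 0 < P.rPatchSqAt φ l := (by positivity : 0 < r ^ 2).trans_le h
  have hcurv : P.curv φ l ≠ 0 := fun h0 => by simp [rPatchSqAt, h0] at hpos
  have hden : 0 ≤ 8 * P.curv φ l * P.freqSum φ l + 24 * P.beta φ l := by
    have := P.curv_nonneg φ l
    have := P.freqSum_nonneg φ l
    have := P.beta_nonneg φ l
    positivity
  refine ⟨(P.curv_nonneg φ l).lt_of_ne' hcurv, (le_div_iff₀ (hden.lt_of_ne' fun h0 => ?_)).1 h⟩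
  simp [rPatchSqAt, h0] at hpos

theorem InPatch.freqSum_le (h : P.InPatch φ l r) :
    8 * P.freqSum φ l * r ^ 2 ≤ 9 * P.curv φ l := by
  have := mul_nonneg (sq_nonneg r) (P.beta_nonneg φ l)
  refine le_of_mul_le_mul_left ?_ h.1
  linarith [h.2]

theorem InPatch.curv_sq_le (h : P.InPatch φ l r) : 5 / 8 * P.curv φ l ^ 2
    ≤ (P.curv φ l - 1 / 6 * P.freqSum φ l * r ^ 2) ^ 2 - P.beta φ l * r ^ 2 := by
  linarith [h.2, sq_nonneg (1 / 6 * P.freqSum φ l * r ^ 2)]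

theorem InPatch.sum_le_lossVar (hr : 0 < r) {Λ : Finset (Fin m)}
    (hΛ : ∀ l ∈ Λ, P.InPatch φ l r) :
    ∑ l ∈ Λ, r ^ 4 / 45 *
        ((P.curv φ l - 1 / 6 * P.freqSum φ l * r ^ 2) ^ 2 - P.beta φ l * r ^ 2)
      ≤ P.lossVar φ r :=
  P.sum_le_lossVar φ hr fun l hl => by
    linarith [(hΛ l hl).freqSum_le, P.curv_nonneg φ l]

theorem InPatch.sum_curv_sq_le_lossVar (hr : 0 < r) {Λ : Finset (Fin m)}
    (hΛ : ∀ l ∈ Λ, P.InPatch φ l r) :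
    1 / 72 * (∑ l ∈ Λ, P.curv φ l ^ 2) * r ^ 4 ≤ P.lossVar φ r := by
  refine le_trans ?_ (InPatch.sum_le_lossVar hr hΛ)
  rw [Finset.mul_sum, Finset.sum_mul]
  refine Finset.sum_le_sum fun l hl => ?_
  have := mul_le_mul_of_nonneg_left (hΛ l hl).curv_sq_le (by positivity : 0 ≤ r ^ 4 / 45)
  linarith

theorem inPatch_of_sq_le_rPatchSq (hr : 0 < r) {Λ : Finset (Fin m)} {hΛ : Λ.Nonempty}
    (h : r ^ 2 ≤ P.rPatchSq φ Λ hΛ) : ∀ l ∈ Λ, P.InPatch φ l r := fun _ hl =>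
  inPatch_of_sq_le_rPatchSqAt hr (h.trans (Finset.inf'_le _ hl))

end Patch

section PolynomialBounds

variable {w : ℝ} (hw : ∀ i, P.maxFreq i ≤ w) (l : Fin m)

theorem curv_le : P.curv φ l ≤ P.maxFreq l ^ 2 * ‖P.obs‖ := by
  rw [curv, partialSq_loss]
  exact (P.abs_lossDeriv_le _ _).trans (P.norm_heisenbergDeriv_single_two_le l φ)

theorem effFreq_sq_le : P.effFreq φ l ^ 2 ≤ P.maxFreq l ^ 2 * ‖P.obs‖ :=
  P.effFreq_sq φ l ▸ P.norm_heisenbergDeriv_single_two_le l φ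

theorem effFreq₂_sq_le {μ : Fin m} (hμ : l < μ) :
    P.effFreq₂ φ l μ ^ 2 ≤ P.maxFreq μ ^ 2 * (P.maxFreq l ^ 2 * ‖P.obs‖) := by
  rw [effFreq₂_sq]
  refine (P.norm_heisenbergDeriv_add_single_le
    (fun i hi => Pi.single_eq_of_ne (hμ.trans hi).ne' 2) 2 φ).trans ?_
  exact mul_le_mul_of_nonneg_left (P.norm_heisenbergDeriv_single_two_le l φ) (sq_nonneg _)

include hw

theorem freqSum_le : P.freqSum φ l ≤ 4 * m * w ^ 4 * ‖P.obs‖ := by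
  have hsq (i : Fin m) : P.maxFreq i ^ 2 ≤ w ^ 2 := pow_le_pow_left₀ (P.maxFreq_nonneg i) (hw i) 2
  have hIio : ∑ μ ∈ Finset.Iio l, P.effFreq φ μ ^ 2 ≤ l * (w ^ 2 * ‖P.obs‖) := by
    have := Finset.sum_le_card_nsmul (Finset.Iio l) _ (w ^ 2 * ‖P.obs‖) fun μ _ =>
      (P.effFreq_sq_le φ μ).trans (mul_le_mul_of_nonneg_right (hsq μ) (norm_nonneg _))
    rwa [Fin.card_Iio, nsmul_eq_mul] at this
  have hIoi : ∑ μ ∈ Finset.Ioi l, P.effFreq₂ φ l μ ^ 2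
      ≤ (m - 1 - l : ℕ) * (w ^ 2 * (w ^ 2 * ‖P.obs‖)) := by
    have := Finset.sum_le_card_nsmul (Finset.Ioi l) _ (w ^ 2 * (w ^ 2 * ‖P.obs‖)) fun μ hμ =>
      (P.effFreq₂_sq_le φ l (Finset.mem_Ioi.1 hμ)).trans <|
        mul_le_mul (hsq μ) (mul_le_mul_of_nonneg_right (hsq l) (norm_nonneg _))
          (by positivity) (by positivity)
    rwa [Fin.card_Ioi, nsmul_eq_mul] at this
  have hcard : (l : ℝ) + (m - 1 - l : ℕ) ≤ m := by
    have := l.isLt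
    exact_mod_cast (by omega : (l : ℕ) + (m - 1 - l) ≤ m)
  calc P.freqSum φ l
      ≤ 4 * w ^ 2 * (l * (w ^ 2 * ‖P.obs‖))
        + 4 * ((m - 1 - l : ℕ) * (w ^ 2 * (w ^ 2 * ‖P.obs‖))) := by
        refine add_le_add ?_ (hIoi.trans (le_mul_of_one_le_left (by positivity) (by norm_num)))
        exact mul_le_mul (mul_le_mul_of_nonneg_left (hsq l) (by norm_num)) hIio
          (by positivity) (by positivity)
    _ = 4 * (l + (m - 1 - l : ℕ)) * w ^ 4 * ‖P.obs‖ := by ring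
    _ ≤ 4 * m * w ^ 4 * ‖P.obs‖ := by gcongr

theorem beta_le : P.beta φ l ≤ 32 / 3 * w ^ 6 * ‖P.obs‖ ^ 2 := by
  have hω := P.maxFreq_nonneg l
  have hpow := mul_le_mul_of_nonneg_right (pow_le_pow_left₀ hω (hw l) 6) (sq_nonneg ‖P.obs‖)
  unfold beta
  split_ifs
  · have heff := pow_le_pow_left₀ (sq_nonneg _) (P.effFreq_sq_le φ l) 2
    have := mul_le_mul_of_nonneg_left heff (sq_nonneg (P.maxFreq l))
    have : 0 ≤ P.maxFreq l ^ 6 * ‖P.obs‖ ^ 2 := by positivity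
    linarith
  · linarith

variable {φ l} in
theorem inPatch_of_sq_le {r : ℝ} (hcurv : 0 < P.curv φ l)
    (h : 32 * (r * √m * w ^ 3 * ‖P.obs‖) ^ 2 ≤ P.curv φ l ^ 2) : P.InPatch φ l r := by
  have hm : (1 : ℝ) ≤ m := by exact_mod_cast l.pos
  have hc : P.curv φ l ≤ w ^ 2 * ‖P.obs‖ := (P.curv_le φ l).trans
    (by have := P.maxFreq_nonneg l; have := hw l; gcongr)
  refine ⟨hcurv, ?_⟩
  calc r ^ 2 * (8 * P.curv φ l * P.freqSum φ l + 24 * P.beta φ l)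
      ≤ r ^ 2 * (8 * (w ^ 2 * ‖P.obs‖) * (4 * m * w ^ 4 * ‖P.obs‖)
          + 24 * (32 / 3 * w ^ 6 * ‖P.obs‖ ^ 2)) := by
        have := P.freqSum_nonneg φ l
        have := P.freqSum_le φ hw l
        have := P.beta_le φ hw l
        gcongr
    _ = 32 * (m + 8 * 1) * (r ^ 2 * w ^ 6 * ‖P.obs‖ ^ 2) := by ring
    _ ≤ 32 * (m + 8 * m) * (r ^ 2 * w ^ 6 * ‖P.obs‖ ^ 2) := by gcongr
    _ = 9 * (32 * (r * √m * w ^ 3 * ‖P.obs‖) ^ 2) := by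
        linear_combination (- 288 * r ^ 2 * w ^ 6 * ‖P.obs‖ ^ 2) * Real.sq_sqrt m.cast_nonneg
    _ ≤ 9 * P.curv φ l ^ 2 := by gcongr

end PolynomialBounds

end VarProblem

section Asymptotics

variable {ι : Type*} {u : Filter ι} {p r s x y : ι → ℝ}

theorem isBigO_mul_one_div (hs : ∀ᶠ i in u, s i ≠ 0) (hx : ∀ᶠ i in u, x i ≠ 0)
    (hp : x =O[u] p) (hr : r =O[u] fun i => 1 / (p i * s i)) :
    (fun i => r i * s i) =O[u] fun i => 1 / x i := by
  have hinv : (fun i => 1 / p i) =O[u] fun i => 1 / x i := by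
    simpa only [one_div] using hp.inv_rev (hx.mono fun _ hi h0 => absurd h0 hi)
  refine ((hr.mul (isBigO_refl s u)).congr' .rfl ?_).trans hinv
  filter_upwards [hs] with i hi
  field_simp

theorem one_div_mul_isBigO (hs : ∀ᶠ i in u, s i ≠ 0) (hpne : ∀ᶠ i in u, p i ≠ 0)
    (hp : p =O[u] y) (hr : (fun i => 1 / (p i * s i)) =O[u] r) :
    (fun i => 1 / (y i * s i)) =O[u] r := by
  refine IsBigO.trans ?_ hr
  simp only [one_div]
  refine (hp.mul (isBigO_refl s u)).inv_rev ?_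
  filter_upwards [hs, hpne] with i hsi hpi h0 using absurd h0 (mul_ne_zero hpi hsi)

theorem isLittleO_one_div_pow_succ (c : ℕ) :
    (fun n : ℕ => 1 / (n : ℝ) ^ (c + 1)) =o[atTop] fun n : ℕ => 1 / (n : ℝ) ^ c := by
  have h := (isBigO_refl (fun n : ℕ => 1 / (n : ℝ) ^ c) atTop).mul_isLittleO
    ((isLittleO_one_iff ℝ).2 (tendsto_one_div_atTop_nhds_zero_nat (𝕜 := ℝ)))
  simpa only [mul_one, one_div_mul_one_div, pow_succ] using h

theorem eventually_natCast_ne_zero : ∀ᶠ n : ℕ in atTop, (n : ℝ) ≠ 0 :=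
  (eventually_ne_atTop 0).mono fun _ => Nat.cast_ne_zero.2

namespace VarProblem

variable {a b c k₀ k₁ : ℕ} {m : ℕ → ℕ} {P : ∀ n, VarProblem n (m n)} {φ : ∀ n, Fin (m n) → ℝ}
  {q : ∀ n, Fin (m n)} {p r : ℕ → ℝ}

theorem eventually_inPatch (hm : ∀ᶠ n in atTop, √(m n : ℝ) ≠ 0)
    (hobs : (fun n => ‖(P n).obs‖) =O[atTop] fun n : ℕ => (n : ℝ) ^ a)
    (hgen : ∃ C : ℝ, ∀ᶠ n : ℕ in atTop, ∀ j, ‖(P n).gen j‖ ≤ C * (n : ℝ) ^ b)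
    (hcurv : (fun n : ℕ => 1 / (n : ℝ) ^ c) =O[atTop] fun n => (P n).curv (φ n) (q n))
    (hp : (fun n : ℕ => (n : ℝ) ^ (3 * b + a + c + 1)) =O[atTop] p)
    (hr : r =O[atTop] fun n => 1 / (p n * √(m n))) :
    ∀ᶠ n in atTop, (P n).InPatch (φ n) (q n) (r n) := by
  obtain ⟨C, hC⟩ := hgen
  have hne (k : ℕ) : ∀ᶠ n : ℕ in atTop, (n : ℝ) ^ k ≠ 0 :=
    eventually_natCast_ne_zero.mono fun _ => pow_ne_zero k
  have hw : (fun n : ℕ => 2 * (C * (n : ℝ) ^ b)) =O[atTop] fun n : ℕ => (n : ℝ) ^ b :=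
    ((isBigO_refl _ _).const_mul_left C).const_mul_left 2
  have hsmall : (fun n => r n * √(m n) * (2 * (C * (n : ℝ) ^ b)) ^ 3 * ‖(P n).obs‖)
      =O[atTop] fun n : ℕ => 1 / (n : ℝ) ^ (c + 1) := by
    refine (((isBigO_mul_one_div hm (hne _) hp hr).mul (hw.pow 3)).mul hobs).congr' .rfl ?_
    filter_upwards [eventually_natCast_ne_zero] with n hn
    field_simp
    ring
  have hlittle := (hsmall.trans_isLittleO (isLittleO_one_div_pow_succ c)).trans_isBigO hcurv
  filter_upwards [hC, hlittle.def (by norm_num : (0 : ℝ) < 1 / 6), hcurv.eq_zero_imp, hne c]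
    with n hgen_le hX hzero hn
  have hpos : 0 < (P n).curv (φ n) (q n) :=
    ((P n).curv_nonneg _ _).lt_of_ne' fun h0 => one_div_ne_zero hn (hzero h0)
  have hsq := pow_le_pow_left₀ (norm_nonneg _) hX 2
  rw [mul_pow (1 / 6), Real.norm_eq_abs, Real.norm_eq_abs, sq_abs, sq_abs] at hsq
  refine (P n).inPatch_of_sq_le (w := 2 * (C * (n : ℝ) ^ b)) (fun j => ?_) hpos ?_
  · exact (maxFreqOf_le _).trans (mul_le_mul_of_nonneg_left (hgen_le j) zero_le_two)
  · linarith [sq_nonneg ((P n).curv (φ n) (q n))]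

theorem isBigO_lossVar (hm : ∀ᶠ n in atTop, √(m n : ℝ) ≠ 0)
    (hpatch : ∀ᶠ n in atTop, (P n).InPatch (φ n) (q n) (r n))
    (hcurv : (fun n : ℕ => 1 / (n : ℝ) ^ c) =O[atTop] fun n => (P n).curv (φ n) (q n))
    (hpne : ∀ᶠ n in atTop, p n ≠ 0) (hp : p =O[atTop] fun n : ℕ => (n : ℝ) ^ k₁)
    (hrpos : ∀ n, 0 < r n) (hr : (fun n => 1 / (p n * √(m n))) =O[atTop] r) :
    (fun n : ℕ => 1 / ((n : ℝ) ^ (2 * c + 4 * k₁) * (m n : ℝ) ^ 2))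
      =O[atTop] fun n => (P n).lossVar (φ n) (r n) := by
  have hvar : (fun n => (P n).curv (φ n) (q n) ^ 2 * r n ^ 4)
      =O[atTop] fun n => (P n).lossVar (φ n) (r n) := by
    refine IsBigO.of_bound 72 ?_
    filter_upwards [hpatch] with n hn
    have hbound := InPatch.sum_curv_sq_le_lossVar (hrpos n) (Λ := {q n}) (by simpa using hn)
    rw [Finset.sum_singleton] at hbound
    have hnonneg : 0 ≤ (P n).lossVar (φ n) (r n) := variance_nonneg _ _
    rw [Real.norm_of_nonneg (by positivity), Real.norm_of_nonneg hnonneg]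
    linarith
  refine (((hcurv.pow 2).mul ((one_div_mul_isBigO hm hpne hp hr).pow 4)).trans hvar).congr_left
    fun n => ?_
  have hsq : √(m n : ℝ) ^ 4 = (m n : ℝ) ^ 2 := by
    rw [show 4 = 2 * 2 from rfl, pow_mul, Real.sq_sqrt (m n).cast_nonneg]
  rw [div_pow, div_pow, mul_pow, hsq, one_pow, one_pow, ← pow_mul, ← pow_mul, one_div_mul_one_div,
    ← mul_assoc, ← pow_add, mul_comm c, mul_comm k₁]

end VarProblem

end Asymptotics

theorem theorem1 :
    -- explicit bounds
    (∀ (n m : ℕ) (P : VarProblem n m) (φ : Fin m → ℝ) (Λ : Finset (Fin m)) (hΛ : Λ.Nonempty),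
      (∀ r : ℝ, 0 < r → r ^ 2 ≤ P.rPatchSq φ Λ hΛ →
        (∑ l ∈ Λ, r ^ 4 / 45 *
            ((P.curv φ l - 1 / 6 * P.freqSum φ l * r ^ 2) ^ 2 - P.beta φ l * r ^ 2)
          ≤ P.lossVar φ r) ∧
        1 / 72 * (∑ l ∈ Λ, P.curv φ l ^ 2) * r ^ 4 ≤ P.lossVar φ r) ∧
      (0 < P.rPatch φ Λ hΛ →
        1 / 72 * (∑ l ∈ Λ, P.curv φ l ^ 2) * P.rPatch φ Λ hΛ ^ 4
          ≤ P.lossVar φ (P.rPatch φ Λ hΛ))) ∧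
    -- asymptotic guarantee
    (∀ a b c : ℕ, ∃ k₀ : ℕ, ∀ k₁ : ℕ, ∃ k₂ : ℕ,
      ∀ (m : ℕ → ℕ) (P : ∀ n, VarProblem n (m n)) (φ : ∀ n, Fin (m n) → ℝ) (q : ∀ n, Fin (m n)),
        ((fun n => ‖(P n).obs‖) =O[atTop] fun n : ℕ => (n : ℝ) ^ a) →
        (∃ C : ℝ, ∀ᶠ n : ℕ in atTop, ∀ j, ‖(P n).gen j‖ ≤ C * (n : ℝ) ^ b) →
        ((fun n : ℕ => 1 / (n : ℝ) ^ c) =O[atTop] fun n => (P n).curv (φ n) (q n)) →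
        ∀ (p r : ℕ → ℝ),
          ((fun n : ℕ => (n : ℝ) ^ k₀) =O[atTop] p) →
          (p =O[atTop] fun n : ℕ => (n : ℝ) ^ k₁) →
          (∀ n, 0 < r n) →
          (r =Θ[atTop] fun n => 1 / (p n * Real.sqrt (m n))) →
          ((fun n : ℕ => 1 / ((n : ℝ) ^ k₂ * (m n : ℝ) ^ 2))
            =O[atTop] fun n => (P n).lossVar (φ n) (r n))) := by
  refine ⟨fun n m P φ Λ hΛ => ⟨fun r hr h => ?_, fun hr => ?_⟩,
    fun a b c => ⟨3 * b + a + c + 1, fun k₁ => ⟨2 * c + 4 * k₁, ?_⟩⟩⟩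
  · have hpatch := VarProblem.inPatch_of_sq_le_rPatchSq hr h
    exact ⟨VarProblem.InPatch.sum_le_lossVar hr hpatch,
      VarProblem.InPatch.sum_curv_sq_le_lossVar hr hpatch⟩
  · have hsq : P.rPatch φ Λ hΛ ^ 2 = P.rPatchSq φ Λ hΛ := Real.sq_sqrt (Real.sqrt_pos.1 hr).le
    exact VarProblem.InPatch.sum_curv_sq_le_lossVar hr
      (VarProblem.inPatch_of_sq_le_rPatchSq hr hsq.le)
  · intro m P φ q hobs hgen hcurv p r hp hp' hrpos hr
    have hm : ∀ᶠ n in atTop, √(m n : ℝ) ≠ 0 := .of_forall fun n =>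
      (Real.sqrt_pos.2 (Nat.cast_pos.2 (q n).pos)).ne'
    have hpne : ∀ᶠ n in atTop, p n ≠ 0 := by
      filter_upwards [hp.eq_zero_imp, eventually_natCast_ne_zero] with n hzero hn hpn
      exact pow_ne_zero _ hn (hzero hpn)
    have hpatch := VarProblem.eventually_inPatch hm hobs hgen hcurv hp hr.1
    exact VarProblem.isBigO_lossVar hm hpatch hcurv hpne hp' hrpos hr.2
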